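/- Let $(X,\omega,J)$ be a Gromov manifold of real dimension $2n$: a smooth manifold with a symplectic form $\omega$ and an almost complex structure $J$ such that $\omega(Jv,Jw)=\omega(v,w)$ and $\omega(Jv,v)>0$ for all tangent vectors $v,w$ at the same point with $v\neq 0$. Let $\langle v,w\rangle=\omega(Jv,w)$ be its riemannian metric, $\nabla$ the Levi-Civita connection and $(\mathrm{Hess}\,u)(v,w)=vwu-(\nabla_vw)u$. A Lagrangian plane at $x$ is an $n$-dimensional subspace $W\subset T_xX$ with $\omega|_W=0$, and $\mathrm{tr}_W\mathrm{Hess}\,u$ is the trace of $\mathrm{Hess}_x u|_W$ with respect to the metric. A smooth function $u$ on an open set is Lag-psh (strictly Lag-psh) there if $\mathrm{tr}_W\mathrm{Hess}\,u\ge 0$ (respectively $>0$) for all Lagrangian planes $W$ at all of its points. Let $\Omega\subset X$ be an open set with compact closure. A defining function for $\partial\Omega$ is a smooth real function $\rho$ on a neighborhood of $\overline\Omega$ with $\Omega=\{\rho<0\}$ and $d\rho\ne0$ on $\partial\Omega$. Suppose that $\partial\Omega$ is smooth and strictly Lagrangian convex, that is, for some defining function $\rho_0$ one has $\mathrm{tr}_W\mathrm{Hess}\,\rho_0>0$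 for every Lagrangian plane $W\subset T_x\partial\Omega=\ker d_x\rho_0$ and every $x\in\partial\Omega$. Then for every defining function $\rho$ for $\partial\Omega$, with $\delta=-\rho$, there is a compact set $K\subset\Omega$ such that $-\log\delta$ is strictly Lag-psh on $\Omega\setminus K$. Moreover $\Omega$ is strictly Lagrangian convex at infinity, in each of the following three (equivalent) senses: 1. for every compact $K\subset\Omega$ the Lagrangian hull $\{x\in\Omega: f(x)\le\sup_K f \text{ for all smooth Lag-psh } f \text{ on } \Omega\}$ is contained in a compact subset of $\Omega$, and there is a smooth function on $\Omega$ that is strictly Lag-psh outside a compact subset of $\Omega$; 2. there is a smooth Lag-psh proper exhaustion function $f$ on $\Omega$ (every set $\{x\in\Omega: f(x)\le c\}$ is compact) that is strictly Lag-psh outside a compact subset of $\Omega$; 3. there are a compact $K\subset\Omega$ and a smooth strictly Lag-psh function $v$ on $\Omega\setminus K$ such that for each $c$ one has $v>c$ outside some compact subset of $\Omega$ containing $K$. -/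

import Mathlib

open scoped Manifold ContDiff

noncomputable section

/-! ### Bilinear forms, traces and the Christoffel symbols of a metric on a vector space -/

/-- The trace `tr_W B` of a bilinear form `B` on the subspace `W`, with respect to the inner product
`g`: in a basis `b` of `W` it is `∑ g^{ij} B(b i, b j)`, where `(g^{ij})` is the inverse of the Gram
matrix of `b`. In a `g`-orthonormal basis `e` of `W` it is `∑ B(e i, e i)`. -/
def traceOn {V : Type*} [AddCommGroup V] [Module ℝ V] [FiniteDimensional ℝ V]
    (g B : V → V → ℝ) (W : Submodule ℝ V) : ℝ :=
  ((Matrix.of fun i j => g (Module.finBasis ℝ W i) (Module.finBasis ℝ W j))⁻¹ *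
    (Matrix.of fun i j => B (Module.finBasis ℝ W i) (Module.finBasis ℝ W j))).trace

/-- In an orthonormal basis `e` of `W`, the trace on `W` is `∑ B(e i, e i)`. -/
theorem traceOn_eq_sum {V : Type*} [AddCommGroup V] [Module ℝ V] [FiniteDimensional ℝ V]
    (g B : LinearMap.BilinForm ℝ V) (W : Submodule ℝ V) {ι : Type*} [Fintype ι] [DecidableEq ι]
    (e : Module.Basis ι ℝ W) (he : ∀ i j, g (e i) (e j) = if i = j then 1 else 0) :
    traceOn (fun v w => g v w) (fun v w => B v w) W = ∑ i, B (e i) (e i) := by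
  set b := Module.finBasis ℝ W
  set P : Matrix ι (Fin _) ℝ := e.toMatrix b
  have key (A : LinearMap.BilinForm ℝ V) :
      (Matrix.of fun i j => A (b i) (b j)) = P.transpose * (Matrix.of fun i j => A (e i) (e j)) * P := by
    ext i j
    have h (k) : (b k : V) = ∑ l, P l k • (e l : V) := by
      have := congrArg (Subtype.val) (e.sum_toMatrix_smul_self b k)
      rw [← this]
      simp [P, -Module.Basis.sum_toMatrix_smul_self]
    simp only [Matrix.of_apply, Matrix.mul_apply, Matrix.transpose_apply]
    rw [h i, h j]
    simp only [map_sum, LinearMap.sum_apply, map_smul, LinearMap.smul_apply, smul_eq_mul,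
      Finset.sum_mul, Finset.mul_sum]
    refine Finset.sum_congr rfl fun _ _ => Finset.sum_congr rfl fun _ _ => by ring
  have h1 : (Matrix.of fun i j => g (e i) (e j)) = 1 := by
    ext i j; simp [he, Matrix.one_apply]
  have hPQ : P * b.toMatrix e = 1 := e.toMatrix_mul_toMatrix_flip b
  have hQP : b.toMatrix e * P = 1 := b.toMatrix_mul_toMatrix_flip e
  have hinv : (P.transpose * P)⁻¹ = b.toMatrix e * (b.toMatrix e).transpose := by
    apply Matrix.inv_eq_left_inv
    calc _ = b.toMatrix e * ((P * b.toMatrix e).transpose) * P := by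
          simp only [Matrix.transpose_mul, Matrix.mul_assoc]
      _ = 1 := by simp [hPQ, hQP]
  unfold traceOn
  change ((Matrix.of fun i j => g (b i) (b j))⁻¹ * (Matrix.of fun i j => B (b i) (b j))).trace = _
  rw [key g, key B, h1, Matrix.mul_one, hinv]
  have : b.toMatrix e * (b.toMatrix e).transpose * (P.transpose * (Matrix.of fun i j => B (e i) (e j)) * P)
     = b.toMatrix e * ((P * b.toMatrix e).transpose * (Matrix.of fun i j => B (e i) (e j)) * P) := by
    simp only [Matrix.transpose_mul, Matrix.mul_assoc]
  rw [this, hPQ, Matrix.transpose_one, Matrix.one_mul, Matrix.trace_mul_comm, Matrix.mul_assoc, hPQ]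
  simp [Matrix.trace]

section

variable {E : Type*} [NormedAddCommGroup E] [NormedSpace ℝ E]

/-- The Levi-Civita connection `∇_v w = Γ(v, w)` of a metric `g` on an open subset of the vector
space `E`, at the point `y` and for constant vector fields `v` and `w`. It is given by the
Christoffel formula: `g(Γ(v, w), z) = (1/2) (D_v g(w, z) + D_w g(v, z) - D_z g(v, w))` for all
`z`. Here `(g y).inverse` is the isomorphism from covectors to vectors given by the metric. -/
def christoffel (g : E → E →L[ℝ] E →L[ℝ] ℝ) (y v w : E) : E :=
  (g y).inverse ((1 / 2 : ℝ) • (fderiv ℝ g y v w + fderiv ℝ g y w v -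
    ((fderiv ℝ g y).flip v).flip w))

/-- The riemannian hessian of `u` for a metric `g` on an open subset of the vector space `E`, at `y`:
`v w u - (∇_v w) u` for constant vector fields `v` and `w`. -/
def coordHess (g : E → E →L[ℝ] E →L[ℝ] ℝ) (u : E → ℝ) (y v w : E) : ℝ :=
  fderiv ℝ (fderiv ℝ u) y v w - fderiv ℝ u y (christoffel g y v w)

variable {X : Type*} [TopologicalSpace X] [ChartedSpace E X]

/-- The coordinate expression, in the preferred chart at `x₀`, of a field `B` of bilinear forms
on the tangent spaces of `X`: the pullback `(a, b) ↦ B(D a, D b)` of `B` by the inverse of the chart, whose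
derivative is `D`. -/
def formInChart (B : (x : X) → TangentSpace 𝓘(ℝ, E) x →L[ℝ] TangentSpace 𝓘(ℝ, E) x →L[ℝ] ℝ)
    (x₀ : X) (y : E) : E →L[ℝ] E →L[ℝ] ℝ :=
  let p : X := (extChartAt 𝓘(ℝ, E) x₀).symm y
  let D : E →L[ℝ] TangentSpace 𝓘(ℝ, E) p :=
    mfderiv 𝓘(ℝ, E) 𝓘(ℝ, E) (extChartAt 𝓘(ℝ, E) x₀).symm y
  (ContinuousLinearMap.precomp ℝ D).comp ((B p).comp D)

end

/-! ### Gromov manifolds -/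

/-- The structure `(ω, J)` of a Gromov manifold on the smooth manifold `X`: a symplectic form `ω`,
here `form`, and an almost complex structure `J`, both smooth, with `ω(Jv, Jw) = ω(v, w)` and `ω(Jv, v) > 0` for
`v ≠ 0`. The last condition includes that `ω` is nondegenerate. -/
structure GromovStructure (E : Type*) [NormedAddCommGroup E] [NormedSpace ℝ E]
    (X : Type*) [TopologicalSpace X] [ChartedSpace E X] [IsManifold 𝓘(ℝ, E) ∞ X] where
  form : (x : X) → TangentSpace 𝓘(ℝ, E) x →L[ℝ] TangentSpace 𝓘(ℝ, E) x →L[ℝ] ℝ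
  J : (x : X) → TangentSpace 𝓘(ℝ, E) x →L[ℝ] TangentSpace 𝓘(ℝ, E) x
  contMDiff_form : ContMDiff 𝓘(ℝ, E) (𝓘(ℝ, E).prod 𝓘(ℝ, E →L[ℝ] E →L[ℝ] ℝ)) ∞
    (fun x => Bundle.TotalSpace.mk' (E →L[ℝ] E →L[ℝ] ℝ)
      (E := fun x : X => TangentSpace 𝓘(ℝ, E) x →L[ℝ] TangentSpace 𝓘(ℝ, E) x →L[ℝ] ℝ) x (form x))
  contMDiff_J : ContMDiff 𝓘(ℝ, E) (𝓘(ℝ, E).prod 𝓘(ℝ, E →L[ℝ] E)) ∞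
    (fun x => Bundle.TotalSpace.mk' (E →L[ℝ] E)
      (E := fun x : X => TangentSpace 𝓘(ℝ, E) x →L[ℝ] TangentSpace 𝓘(ℝ, E) x) x (J x))
  form_self : ∀ (x : X) (v : TangentSpace 𝓘(ℝ, E) x), form x v v = 0
  /-- `dω = 0`, written at the point `x` in the chart at `x`. -/
  form_closed : ∀ (x : X) (a b c : E),
    fderiv ℝ (formInChart form x) (extChartAt 𝓘(ℝ, E) x x) a b c +
      fderiv ℝ (formInChart form x) (extChartAt 𝓘(ℝ, E) x x) b c a +
      fderiv ℝ (formInChart form x) (extChartAt 𝓘(ℝ, E) x x) c a b = 0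
  J_J : ∀ (x : X) (v : TangentSpace 𝓘(ℝ, E) x), J x (J x v) = -v
  form_J_J : ∀ (x : X) (v w : TangentSpace 𝓘(ℝ, E) x), form x (J x v) (J x w) = form x v w
  form_J_pos : ∀ (x : X) (v : TangentSpace 𝓘(ℝ, E) x), v ≠ 0 → 0 < form x (J x v) v

/-- `ρ` is a defining function for the boundary of the open set `Ω`: it is smooth on a neighbourhood
`U` of the closure of `Ω`, with `Ω = {ρ < 0}` and `dρ ≠ 0` on the boundary of `Ω`. The values of
`ρ` outside `U` are irrelevant. -/
structure IsDefiningFunction (E : Type*) [NormedAddCommGroup E] [NormedSpace ℝ E]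
    {X : Type*} [TopologicalSpace X] [ChartedSpace E X] (ρ : X → ℝ) (Ω : Set X) : Prop where
  exists_nhds : ∃ U : Set X, IsOpen U ∧ closure Ω ⊆ U ∧
    ContMDiffOn 𝓘(ℝ, E) 𝓘(ℝ, ℝ) ∞ ρ U ∧ Ω = {x ∈ U | ρ x < 0}
  mfderiv_ne_zero : ∀ x ∈ frontier Ω, mfderiv 𝓘(ℝ, E) 𝓘(ℝ, ℝ) ρ x ≠ 0

namespace GromovStructure

variable {E : Type*} [NormedAddCommGroup E] [NormedSpace ℝ E] [FiniteDimensional ℝ E]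
  {X : Type*} [TopologicalSpace X] [ChartedSpace E X] [IsManifold 𝓘(ℝ, E) ∞ X]
  (G : GromovStructure E X)

instance instFiniteDimensionalTangentSpace (x : X) :
    FiniteDimensional ℝ (TangentSpace 𝓘(ℝ, E) x) :=
  inferInstanceAs (FiniteDimensional ℝ E)

/-- The riemannian metric `⟨v, w⟩ = ω(Jv, w)`. -/
def metric (x : X) : TangentSpace 𝓘(ℝ, E) x →L[ℝ] TangentSpace 𝓘(ℝ, E) x →L[ℝ] ℝ :=
  (G.form x).comp (G.J x)

/-- The riemannian hessian `(Hess u)(v, w) = v w u - (∇_v w) u` at `x`, where `∇` is the Levi-Civita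
connection of the metric. It is computed in the chart at `x`, with `v` and `w` extended by constant
vector fields in this chart. -/
def hess (u : X → ℝ) (x : X) (v w : TangentSpace 𝓘(ℝ, E) x) : ℝ :=
  let φ := extChartAt 𝓘(ℝ, E) x
  coordHess (formInChart G.metric x) (u ∘ φ.symm) (φ x)
    (mfderiv 𝓘(ℝ, E) 𝓘(ℝ, E) φ x v) (mfderiv 𝓘(ℝ, E) 𝓘(ℝ, E) φ x w)

/-- `W` is a Lagrangian `n`-plane at `x`, where `2n = dim X`. -/
def IsLagrangian (x : X) (W : Submodule ℝ (TangentSpace 𝓘(ℝ, E) x)) : Prop :=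
  2 * Module.finrank ℝ W = Module.finrank ℝ E ∧ ∀ v ∈ W, ∀ w ∈ W, G.form x v w = 0

/-- The trace `tr_W Hess u` at `x`. -/
def hessTrace (u : X → ℝ) (x : X) (W : Submodule ℝ (TangentSpace 𝓘(ℝ, E) x)) : ℝ :=
  traceOn (fun v w => G.metric x v w) (G.hess u x) W

/-- `u` is smooth and Lagrangian plurisubharmonic on the open set `U`. -/
def LagPshOn (u : X → ℝ) (U : Set X) : Prop :=
  ContMDiffOn 𝓘(ℝ, E) 𝓘(ℝ, ℝ) ∞ u U ∧
    ∀ x ∈ U, ∀ W, G.IsLagrangian x W → 0 ≤ G.hessTrace u x W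

/-- `u` is smooth and strictly Lagrangian plurisubharmonic on the open set `U`. -/
def StrictLagPshOn (u : X → ℝ) (U : Set X) : Prop :=
  ContMDiffOn 𝓘(ℝ, E) 𝓘(ℝ, ℝ) ∞ u U ∧
    ∀ x ∈ U, ∀ W, G.IsLagrangian x W → 0 < G.hessTrace u x W

/-- The boundary of the open set `Ω` is smooth and strictly Lagrangian convex: for some defining
function `ρ`, `tr_W Hess ρ > 0` for every Lagrangian plane `W` at a boundary point that is
tangential, i.e. contained in the tangent space `ker dρ` of the boundary. (The condition does not
depend on the choice of `ρ`.) -/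
def StrictLagConvexBoundary (Ω : Set X) : Prop :=
  ∃ ρ : X → ℝ, IsDefiningFunction E ρ Ω ∧
    ∀ x ∈ frontier Ω, ∀ W, G.IsLagrangian x W →
      (∀ w ∈ W, mfderiv 𝓘(ℝ, E) 𝓘(ℝ, ℝ) ρ x w = 0) → 0 < G.hessTrace ρ x W

/-- The Lagrangian hull, in the open set `Ω` viewed as a Gromov manifold, of a subset `K`:
all `x ∈ Ω` with `f(x) ≤ sup_K f` for each smooth Lagrangian plurisubharmonic `f` on `Ω`. -/
def lagHull (Ω K : Set X) : Set X :=
  {x ∈ Ω | ∀ f : X → ℝ, G.LagPshOn f Ω → ∀ c : ℝ, (∀ y ∈ K, f y ≤ c) → f x ≤ c}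

/-- First form of strict Lagrangian convexity at infinity of the Gromov manifold `Ω`:
hulls of compact sets are relatively compact in `Ω`, and there is a smooth function on `Ω` that is
strictly Lagrangian plurisubharmonic outside a compact set. -/
def HullConvexStrictAtInfinity (Ω : Set X) : Prop :=
  (∀ K ⊆ Ω, IsCompact K → ∃ K' ⊆ Ω, IsCompact K' ∧ G.lagHull Ω K ⊆ K') ∧
    ∃ f : X → ℝ, ContMDiffOn 𝓘(ℝ, E) 𝓘(ℝ, ℝ) ∞ f Ω ∧
      ∃ K ⊆ Ω, IsCompact K ∧ G.StrictLagPshOn f (Ω \ K)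

/-- Second form: there is a smooth Lagrangian plurisubharmonic proper exhaustion function of `Ω` that
is strict outside a compact set. -/
def ExhaustionStrictAtInfinity (Ω : Set X) : Prop :=
  ∃ f : X → ℝ, G.LagPshOn f Ω ∧ (∀ c : ℝ, IsCompact {x ∈ Ω | f x ≤ c}) ∧
    ∃ K ⊆ Ω, IsCompact K ∧ G.StrictLagPshOn f (Ω \ K)

/-- Third form: there is a smooth strictly Lagrangian plurisubharmonic function `v` on a neighbourhood
`Ω \ K` of infinity in `Ω` that tends to infinity at infinity. -/
def StrictNearInfinity (Ω : Set X) : Prop :=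
  ∃ K ⊆ Ω, IsCompact K ∧ ∃ v : X → ℝ, G.StrictLagPshOn v (Ω \ K) ∧
    ∀ c : ℝ, ∃ K' ⊆ Ω, IsCompact K' ∧ K ⊆ K' ∧ ∀ x ∈ Ω \ K', c < v x

/-- The open set `Ω`, with the Gromov structure restricted from `X`, is strictly Lagrangian convex at
infinity. The notion is defined by any of three equivalent conditions; so as not to rely on their
equivalence, all three are required. For `Ω = X` this is the notion for `X` itself. -/
def StrictLagConvexAtInfinity (Ω : Set X) : Prop :=
  G.HullConvexStrictAtInfinity Ω ∧ G.ExhaustionStrictAtInfinity Ω ∧ G.StrictNearInfinity Ω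

end GromovStructure

end

set_option maxSynthPendingDepth 3

open Filter Topology

open scoped Manifold ContDiff

noncomputable section

section Coordinates

variable {E : Type*} [NormedAddCommGroup E] [NormedSpace ℝ E]

/-! ### The hessian in coordinates -/

/-! With `δ = -ρ`, the chain rule gives `Hess (-log δ) = δ⁻¹ (Hess ρ + δ⁻¹ dρ ⊗ dρ)`. Suppose that
the bracket has nonpositive trace on Lagrangian planes at points of `Ω` tending to a boundary point.
Orthonormal frames of these planes subconverge. Multiplying by `δ → 0` shows that `dρ` vanishes on
the limit frame, so the limit plane is tangential. Dropping the nonnegative term `δ⁻¹ dρ ⊗ dρ` shows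
that `Hess ρ` has nonpositive trace on it, against strict convexity. This is
`eventually_sum_add_inv_mul_sq_pos`; compactness of the closure of `Ω` then yields the exceptional
set `K`.

Convexity is given for one defining function `ρ₀` only. At a boundary point `dρ = c dρ₀` with `c >
0`, and `D²ρ ≥ c D²ρ₀` on tangential vectors, because the two functions are negative at the same
nearby points (`exists_pos_fderiv_eq_smul_and_le`). The Christoffel correction depends on the
differential alone, so the riemannian hessians satisfy the same inequality. The limit argument needs
one fixed chart, whereas `hess` uses a different chart at each point; `coordHess_pullback` bridges
the two.

For convexity at infinity, `v = -log δ` has compact sublevel sets in `Ω`. If `v < m` on `K` and `χ`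
is smooth, zero on `t ≤ 0`, and increasing and convex on `t > 0`, then `χ(v - m)` is Lag-psh on all
of `Ω` and strict where `v > m`. It is an exhaustion, and its sublevel sets contain the hulls of
compact sets; `v` itself serves for the third form. -/

theorem christoffel_spec {g : E → E →L[ℝ] E →L[ℝ] ℝ} {y : E} (hg : (g y).IsInvertible) (v w z : E) :
    g y (christoffel g y v w) z =
      1 / 2 * (fderiv ℝ g y v w z + fderiv ℝ g y w v z - fderiv ℝ g y z v w) := by
  unfold christoffel
  rw [hg.self_apply_inverse]
  simp

theorem coordHess_add_left (g : E → E →L[ℝ] E →L[ℝ] ℝ) (u : E → ℝ) (y v v' w : E) :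
    coordHess g u y (v + v') w = coordHess g u y v w + coordHess g u y v' w := by
  have : christoffel g y (v + v') w = christoffel g y v w + christoffel g y v' w := by
    unfold christoffel
    rw [← map_add]
    congr 1
    ext z
    simp
    ring
  simp only [coordHess, this, map_add, add_apply]
  ring

theorem coordHess_smul_left (g : E → E →L[ℝ] E →L[ℝ] ℝ) (u : E → ℝ) (y : E) (c : ℝ) (v w : E) :
    coordHess g u y (c • v) w = c * coordHess g u y v w := by
  have : christoffel g y (c • v) w = c • christoffel g y v w := by
    unfold christoffel
    rw [← map_smul]
    congr 1
    ext z
    simp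
    ring
  simp only [coordHess, this, map_smul, smul_apply, smul_eq_mul]
  ring

theorem coordHess_add_right (g : E → E →L[ℝ] E →L[ℝ] ℝ) (u : E → ℝ) (y v w w' : E) :
    coordHess g u y v (w + w') = coordHess g u y v w + coordHess g u y v w' := by
  have : christoffel g y v (w + w') = christoffel g y v w + christoffel g y v w' := by
    unfold christoffel
    rw [← map_add]
    congr 1
    ext z
    simp
    ring
  simp only [coordHess, this, map_add]
  ring

theorem coordHess_smul_right (g : E → E →L[ℝ] E →L[ℝ] ℝ) (u : E → ℝ) (y : E) (c : ℝ) (v w : E) :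
    coordHess g u y v (c • w) = c * coordHess g u y v w := by
  have : christoffel g y v (c • w) = c • christoffel g y v w := by
    unfold christoffel
    rw [← map_smul]
    congr 1
    ext z
    simp
    ring
  simp only [coordHess, this, map_smul, smul_eq_mul]
  ring

theorem ContDiffAt.eventually_differentiableAt {F : Type*} [NormedAddCommGroup F] [NormedSpace ℝ F]
    {u : E → F} {y : E} (hu : ContDiffAt ℝ 2 u y) : ∀ᶠ z in 𝓝 y, DifferentiableAt ℝ u z :=
  (hu.eventually (by simp)).mono fun _ hz => hz.differentiableAt (by simp)

theorem ContDiffAt.differentiableAt_fderiv {F : Type*} [NormedAddCommGroup F] [NormedSpace ℝ F]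
    {u : E → F} {y : E} (hu : ContDiffAt ℝ 2 u y) : DifferentiableAt ℝ (fderiv ℝ u) y :=
  (hu.fderiv_right (m := 1) (by norm_num)).differentiableAt (by simp)

theorem coordHess_congr {g : E → E →L[ℝ] E →L[ℝ] ℝ} {u u' : E → ℝ} {y : E} (h : u =ᶠ[𝓝 y] u') :
    coordHess g u y = coordHess g u' y := by
  funext v w
  simp only [coordHess, h.fderiv.fderiv_eq, h.fderiv_eq]

/-- The hessian of a composition `χ ∘ u` with a function `χ` of one variable. -/
theorem coordHess_real_comp {g : E → E →L[ℝ] E →L[ℝ] ℝ} {u : E → ℝ} {χ : ℝ → ℝ} {y : E}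
    (hu : ContDiffAt ℝ 2 u y) (hχ : ContDiffAt ℝ 2 χ (u y)) (v w : E) :
    coordHess g (χ ∘ u) y v w = deriv χ (u y) * coordHess g u y v w +
      deriv (deriv χ) (u y) * (fderiv ℝ u y v * fderiv ℝ u y w) := by
  have h1 : fderiv ℝ (χ ∘ u) =ᶠ[𝓝 y] fun z => deriv χ (u z) • fderiv ℝ u z := by
    filter_upwards [hu.eventually_differentiableAt,
      hu.continuousAt.eventually hχ.eventually_differentiableAt] with z hz hz'
    exact (hz'.hasDerivAt.comp_hasFDerivAt z hz.hasFDerivAt).fderiv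
  have hχ' : DifferentiableAt ℝ (deriv χ) (u y) := by
    have := hχ.differentiableAt_fderiv
    exact (this.clm_apply (differentiableAt_const (1 : ℝ)))
  have h2 := (hχ'.hasDerivAt.comp_hasFDerivAt y (hu.differentiableAt (by simp)).hasFDerivAt).smul
    hu.differentiableAt_fderiv.hasFDerivAt
  simp only [coordHess, h1.fderiv_eq, h1.self_of_nhds]
  rw [show (fun z => deriv χ (u z) • fderiv ℝ u z) = (deriv χ ∘ u) • fderiv ℝ u from rfl, h2.fderiv]
  simp
  ring

/-- The hessian does not depend on the coordinates: `g'` and `u'` are the pullbacks of `g` and `u`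
by the local diffeomorphism `ψ`. -/
theorem coordHess_pullback {g g' : E → E →L[ℝ] E →L[ℝ] ℝ} {u u' : E → ℝ} {ψ : E → E} {y : E}
    (hψ : ContDiffAt ℝ 2 ψ y) (hψ' : Function.Surjective (fderiv ℝ ψ y))
    (hgg' : ∀ᶠ z in 𝓝 y, ∀ a b, g' z a b = g (ψ z) (fderiv ℝ ψ z a) (fderiv ℝ ψ z b))
    (hg : DifferentiableAt ℝ g (ψ y)) (hg' : DifferentiableAt ℝ g' y)
    (hsymm : ∀ a b, g (ψ y) a b = g (ψ y) b a)
    (hinv : (g (ψ y)).IsInvertible) (hinv' : (g' y).IsInvertible)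
    (hu : ContDiffAt ℝ 2 u (ψ y)) (huu' : u' =ᶠ[𝓝 y] u ∘ ψ) (v w : E) :
    coordHess g' u' y v w = coordHess g u (ψ y) (fderiv ℝ ψ y v) (fderiv ℝ ψ y w) := by
  have hψd : HasFDerivAt ψ (fderiv ℝ ψ y) y := (hψ.differentiableAt (by simp)).hasFDerivAt
  have hψ2 : HasFDerivAt (fderiv ℝ ψ) (fderiv ℝ (fderiv ℝ ψ) y) y :=
    hψ.differentiableAt_fderiv.hasFDerivAt
  have hψs : ∀ a b, fderiv ℝ (fderiv ℝ ψ) y a b = fderiv ℝ (fderiv ℝ ψ) y b a :=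
    fun a b => (hψ.isSymmSndFDerivAt (by simp)) a b
  have happ (a : E) : HasFDerivAt (fun z => fderiv ℝ ψ z a) ((fderiv ℝ (fderiv ℝ ψ) y).flip a) y := by
    have := hψ2.clm_apply (hasFDerivAt_const a y)
    refine this.congr_fderiv ?_
    ext; simp
  have hDg (c a b : E) : fderiv ℝ g' y c a b =
      fderiv ℝ g (ψ y) (fderiv ℝ ψ y c) (fderiv ℝ ψ y a) (fderiv ℝ ψ y b) +
      g (ψ y) (fderiv ℝ (fderiv ℝ ψ) y c a) (fderiv ℝ ψ y b) +
      g (ψ y) (fderiv ℝ ψ y a) (fderiv ℝ (fderiv ℝ ψ) y c b) := by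
    have h1 : HasFDerivAt (fun z => g' z a b) (((fderiv ℝ g' y).flip a).flip b) y := by
      have := (hg'.hasFDerivAt.clm_apply (hasFDerivAt_const a y)).clm_apply (hasFDerivAt_const b y)
      refine this.congr_fderiv ?_
      ext; simp
    have h0 : HasFDerivAt (fun z => g (ψ z)) ((fderiv ℝ g (ψ y)).comp (fderiv ℝ ψ y)) y :=
      hg.hasFDerivAt.comp y hψd
    have h2 := (h0.clm_apply (happ a)).clm_apply (happ b)
    have h3 := h2.congr_of_eventuallyEq (hgg'.mono fun z hz => hz a b)
    have := DFunLike.congr_fun (h1.unique h3) c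
    simp at this
    rw [this]
    ring
  -- The transformation law of the Christoffel symbols. Its inhomogeneous term `D²ψ(v, w)` is the
  -- one that the second derivative of `u ∘ ψ` produces, so the two cancel in the hessian.
  have hΓ : fderiv ℝ ψ y (christoffel g' y v w) =
      christoffel g (ψ y) (fderiv ℝ ψ y v) (fderiv ℝ ψ y w) + fderiv ℝ (fderiv ℝ ψ) y v w := by
    apply hinv.injective
    ext z'
    obtain ⟨z, rfl⟩ := hψ' z'
    rw [← hgg'.self_of_nhds, christoffel_spec hinv', map_add, add_apply,
      christoffel_spec hinv, hDg, hDg, hDg, hψs w v, hψs z v, hψs z w,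
      hsymm (fderiv ℝ (fderiv ℝ ψ) y v z)]
    ring
  have hu1 : fderiv ℝ u' =ᶠ[𝓝 y] fun z => (fderiv ℝ u (ψ z)).comp (fderiv ℝ ψ z) := by
    filter_upwards [huu'.eventuallyEq_nhds, hψ.eventually_differentiableAt,
      hψ.continuousAt.eventually hu.eventually_differentiableAt] with z h1 h2 h3
    rw [h1.fderiv_eq]
    exact fderiv_comp z h3 h2
  have hu2 := (hu.differentiableAt_fderiv.hasFDerivAt.comp y hψd).clm_comp hψ2
  simp only [coordHess, hu1.fderiv_eq, hu1.self_of_nhds]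
  rw [show (fun z => (fderiv ℝ u (ψ z)).comp (fderiv ℝ ψ z)) =
    fun z => ((fderiv ℝ u ∘ ψ) z).comp (fderiv ℝ ψ z) from rfl, hu2.fderiv]
  simp [hΓ]
  ring

theorem ContinuousAt.clm_flip {T F G K : Type*} [TopologicalSpace T] [NormedAddCommGroup F]
    [NormedSpace ℝ F] [NormedAddCommGroup G] [NormedSpace ℝ G] [NormedAddCommGroup K]
    [NormedSpace ℝ K] {f : T → F →L[ℝ] G →L[ℝ] K} {t : T} (h : ContinuousAt f t) :
    ContinuousAt (fun p => (f p).flip) t :=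
  (ContinuousLinearMap.flipₗᵢ ℝ F G K).continuous.continuousAt.comp h

theorem continuousAt_christoffel {g : E → E →L[ℝ] E →L[ℝ] ℝ} {y₀ : E} [CompleteSpace E]
    (hg : ContDiffAt ℝ 1 g y₀) (hinv : (g y₀).IsInvertible) (v₀ : E) :
    ContinuousAt (fun p : E × E => christoffel g p.1 p.2 p.2) (y₀, v₀) := by
  have hfst : ContinuousAt (Prod.fst : E × E → E) (y₀, v₀) := continuousAt_fst
  have hsnd : ContinuousAt (Prod.snd : E × E → E) (y₀, v₀) := continuousAt_snd
  have d3 : ContinuousAt (fderiv ℝ g) y₀ := (hg.fderiv_right (m := 0) (by norm_num)).continuousAt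
  have c3 : ContinuousAt (fun p : E × E => fderiv ℝ g p.1) (y₀, v₀) := d3.comp_of_eq hfst rfl
  have d4 : ContinuousAt (fun y => (g y).inverse) y₀ :=
    (hinv.contDiffAt_map_inverse (n := 0)).continuousAt.comp_of_eq hg.continuousAt rfl
  have c4 : ContinuousAt (fun p : E × E => (g p.1).inverse) (y₀, v₀) := d4.comp_of_eq hfst rfl
  have c5 : ContinuousAt (fun p : E × E => ((fderiv ℝ g p.1).flip p.2).flip p.2) (y₀, v₀) :=
    (c3.clm_flip.clm_apply hsnd).clm_flip.clm_apply hsnd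
  have c6 : ContinuousAt (fun p : E × E => fderiv ℝ g p.1 p.2 p.2) (y₀, v₀) :=
    (c3.clm_apply hsnd).clm_apply hsnd
  exact c4.clm_apply (((c6.add c6).sub c5).const_smul (1 / 2 : ℝ))

theorem continuousAt_coordHess {g : E → E →L[ℝ] E →L[ℝ] ℝ} {u : E → ℝ} {y₀ : E} [CompleteSpace E]
    (hg : ContDiffAt ℝ 1 g y₀) (hinv : (g y₀).IsInvertible) (hu : ContDiffAt ℝ 2 u y₀) (v₀ : E) :
    ContinuousAt (fun p : E × E => coordHess g u p.1 p.2 p.2) (y₀, v₀) := by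
  have hfst : ContinuousAt (Prod.fst : E × E → E) (y₀, v₀) := continuousAt_fst
  have hsnd : ContinuousAt (Prod.snd : E × E → E) (y₀, v₀) := continuousAt_snd
  have d2 : ContDiffAt ℝ 1 (fderiv ℝ u) y₀ := hu.fderiv_right (by norm_num)
  have d1 : ContinuousAt (fderiv ℝ (fderiv ℝ u)) y₀ :=
    (d2.fderiv_right (m := 0) (by norm_num)).continuousAt
  have c1 : ContinuousAt (fun p : E × E => fderiv ℝ (fderiv ℝ u) p.1) (y₀, v₀) :=
    d1.comp_of_eq hfst rfl
  have c2 : ContinuousAt (fun p : E × E => fderiv ℝ u p.1) (y₀, v₀) :=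
    d2.continuousAt.comp_of_eq hfst rfl
  exact ((c1.clm_apply hsnd).clm_apply hsnd).sub
    (c2.clm_apply (continuousAt_christoffel hg hinv v₀))

/-! ### Comparison of two defining functions -/

theorem hasDerivAt_parabola (y v ν : E) (t : ℝ) :
    HasDerivAt (fun t : ℝ => y + t • v + t ^ 2 • ν) (v + (2 * t) • ν) t := by
  have h1 := (((hasDerivAt_id t).smul_const v).const_add y).add ((hasDerivAt_pow 2 t).smul_const ν)
  refine (h1.congr_deriv ?_).congr_of_eventuallyEq (Eventually.of_forall fun s => ?_) <;> simp

theorem deriv_comp_parabola {r : E → ℝ} {y : E} (hr : ContDiffAt ℝ 2 r y) (v ν : E) :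
    deriv (fun t : ℝ => r (y + t • v + t ^ 2 • ν)) =ᶠ[𝓝 0]
      fun t => fderiv ℝ r (y + t • v + t ^ 2 • ν) (v + (2 * t) • ν) := by
  have hc : Tendsto (fun t : ℝ => y + t • v + t ^ 2 • ν) (𝓝 0) (𝓝 y) := by
    have := (hasDerivAt_parabola y v ν 0).continuousAt.tendsto
    simpa using this
  filter_upwards [hc.eventually hr.eventually_differentiableAt] with t ht
  exact (ht.hasFDerivAt.comp_hasDerivAt t (hasDerivAt_parabola y v ν t)).deriv

/-- The term `2 dr(ν)` is the purpose of the parabola: bending the curve by `ν` adjusts the second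
derivative without changing the initial velocity `v`. -/
theorem deriv_deriv_comp_parabola {r : E → ℝ} {y : E} (hr : ContDiffAt ℝ 2 r y) (v ν : E) :
    deriv (deriv (fun t : ℝ => r (y + t • v + t ^ 2 • ν))) 0 =
      fderiv ℝ (fderiv ℝ r) y v v + 2 * fderiv ℝ r y ν := by
  rw [(deriv_comp_parabola hr v ν).deriv_eq]
  have hr' : HasFDerivAt (fderiv ℝ r) (fderiv ℝ (fderiv ℝ r) y) (y + (0 : ℝ) • v + (0 : ℝ) ^ 2 • ν) := by
    simpa using hr.differentiableAt_fderiv.hasFDerivAt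
  have h1 := hr'.comp_hasDerivAt (0 : ℝ) (hasDerivAt_parabola y v ν 0)
  have h2 : HasDerivAt (fun t : ℝ => v + (2 * t) • ν) ((2 : ℝ) • ν) 0 := by
    simpa using (((hasDerivAt_id (0 : ℝ)).const_mul 2).smul_const ν).const_add v
  have := (h1.clm_apply h2).deriv
  simp only [Function.comp_apply] at this
  rw [this]
  simp

/-- If `f'' < 0` at 0, then `f ≤ 0` nearby while `f₀ ≥ 0` nearby. The sign implication leaves only
`f = 0` near 0, so `f'' = 0` after all. -/
theorem deriv_deriv_nonneg_of_neg_imp {f f₀ : ℝ → ℝ} (hf : ContinuousAt f 0) (hf₀ : ContinuousAt f₀ 0)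
    (h0 : f 0 = 0) (h00 : f₀ 0 = 0) (h : ∀ᶠ t in 𝓝 0, f t < 0 → f₀ t < 0)
    (hd : deriv f 0 = 0) (hd₀ : deriv f₀ 0 = 0) (hdd : 0 < deriv (deriv f₀) 0) :
    0 ≤ deriv (deriv f) 0 := by
  by_contra! hneg
  have h1 := isLocalMin_of_deriv_deriv_pos hdd hd₀ hf₀
  have h2 := isLocalMax_of_deriv_deriv_neg hneg hd hf
  have h3 : f =ᶠ[𝓝 0] fun _ => 0 := by
    filter_upwards [h1, h2, h] with t a b c
    by_contra hne
    have : f t < 0 := lt_of_le_of_ne (b.trans_eq h0) hne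
    linarith [c this]
  rw [h3.deriv.deriv_eq] at hneg
  simp at hneg

/-- If `f' < 0` at 0, then `f` is negative and `f₀` positive at small `t > 0`. -/
theorem deriv_nonneg_of_neg_imp {f f₀ : ℝ → ℝ}
    (h0 : f 0 = 0) (h00 : f₀ 0 = 0) (h : ∀ᶠ t in 𝓝 0, f t < 0 → f₀ t < 0)
    (hd₀ : 0 < deriv f₀ 0) : 0 ≤ deriv f 0 := by
  by_contra! hneg
  have h1 := eventually_nhdsWithin_sign_eq_of_deriv_pos hd₀ h00
  have h2 := eventually_nhdsWithin_sign_eq_of_deriv_neg hneg h0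
  obtain ⟨t, ⟨⟨h1, h2⟩, h⟩, ht⟩ :=
    ((((h1.and h2).and h).filter_mono nhdsWithin_le_nhds).and (self_mem_nhdsWithin (s := Set.Ioi (0 : ℝ)))).exists
  have ht : 0 < t := ht
  rw [sub_zero, sign_pos ht, sign_eq_one_iff] at h1
  rw [zero_sub, sign_neg (a := -t) (by linarith), sign_eq_neg_one_iff] at h2
  linarith [h h2]

/-- An inclusion between half-spaces forces their linear forms to be positively proportional: `ℓ -
ℓ(ν) ℓ₀`, with `ℓ₀(ν) = 1`, turns out to be nonnegative on all vectors, hence zero. -/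
theorem ContinuousLinearMap.exists_pos_smul_of_nonneg {ℓ ℓ₀ : E →L[ℝ] ℝ} (hℓ : ℓ ≠ 0) (hℓ₀ : ℓ₀ ≠ 0)
    (h : ∀ v, 0 < ℓ₀ v → 0 ≤ ℓ v) : ∃ c : ℝ, 0 < c ∧ ℓ = c • ℓ₀ := by
  obtain ⟨ν', hν'⟩ : ∃ ν, ℓ₀ ν ≠ 0 := by
    by_contra! hc
    exact hℓ₀ (ContinuousLinearMap.ext hc)
  set ν := (ℓ₀ ν')⁻¹ • ν'
  have hν : ℓ₀ ν = 1 := by simp [ν, hν']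
  have hge (w : E) : ℓ₀ w * ℓ ν ≤ ℓ w := by
    by_contra! hlt
    -- The vector `w` is moved along `ν` to the level `ℓ₀ = ε`, inside the open half-space. Below,
    -- `ε` is so small that `ε ℓ(ν)` is at most half of the supposed gap; the `+ 1` covers `ℓ(ν) =
    -- 0`.
    have hε (ε : ℝ) (hε : 0 < ε) : 0 ≤ ℓ w - (ℓ₀ w - ε) * ℓ ν := by
      have := h (w - (ℓ₀ w - ε) • ν) (by simp [hν, hε])
      simpa using this
    have hν0 : 0 ≤ ℓ ν := h ν (by simp [hν])
    have := hε ((ℓ₀ w * ℓ ν - ℓ w) / (2 * (ℓ ν + 1))) (div_pos (by linarith) (by linarith))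
    have h3 : (ℓ₀ w * ℓ ν - ℓ w) / (2 * (ℓ ν + 1)) * ℓ ν ≤ (ℓ₀ w * ℓ ν - ℓ w) / 2 := by
      rw [div_mul_eq_mul_div, div_le_div_iff₀ (by linarith) (by norm_num)]
      nlinarith
    nlinarith
  have heq : ℓ = ℓ ν • ℓ₀ := by
    ext w
    have h1 := hge w
    have h2 := hge (-w)
    simp only [map_neg] at h2
    simp only [smul_apply, smul_eq_mul]
    nlinarith
  refine ⟨ℓ ν, lt_of_le_of_ne (h ν (by simp [hν])) fun h0 => hℓ ?_, heq⟩
  rw [heq, ← h0, zero_smul]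

/-- Two functions with the same sublevel set `{r < 0}` near a regular boundary point have proportional
derivatives, and their second derivatives are proportional in tangential directions. -/
theorem exists_pos_fderiv_eq_smul_and_le {r r₀ : E → ℝ} {y : E} (hr : ContDiffAt ℝ 2 r y)
    (hr₀ : ContDiffAt ℝ 2 r₀ y) (h0 : r y = 0) (h00 : r₀ y = 0)
    (h : ∀ᶠ z in 𝓝 y, r z < 0 → r₀ z < 0) (hd : fderiv ℝ r y ≠ 0) (hd₀ : fderiv ℝ r₀ y ≠ 0) :
    ∃ c : ℝ, 0 < c ∧ fderiv ℝ r y = c • fderiv ℝ r₀ y ∧ ∀ v, fderiv ℝ r₀ y v = 0 →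
      c * fderiv ℝ (fderiv ℝ r₀) y v v ≤ fderiv ℝ (fderiv ℝ r) y v v := by
  have hp (v ν : E) : Tendsto (fun t : ℝ => y + t • v + t ^ 2 • ν) (𝓝 0) (𝓝 y) := by
    simpa using (hasDerivAt_parabola y v ν 0).continuousAt.tendsto
  have hy (v ν : E) : y + (0 : ℝ) • v + (0 : ℝ) ^ 2 • ν = y := by simp
  have hder {q : E → ℝ} (hq : ContDiffAt ℝ 2 q y) (v ν : E) :
      deriv (fun t : ℝ => q (y + t • v + t ^ 2 • ν)) 0 = fderiv ℝ q y v := by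
    rw [(deriv_comp_parabola hq v ν).self_of_nhds]
    simp
  have hcont {q : E → ℝ} (hq : ContDiffAt ℝ 2 q y) (v ν : E) :
      ContinuousAt (fun t : ℝ => q (y + t • v + t ^ 2 • ν)) 0 := by
    have := hq.continuousAt.tendsto.comp (hp v ν)
    rw [ContinuousAt, hy]
    exact this
  obtain ⟨c, hc, hcr⟩ := ContinuousLinearMap.exists_pos_smul_of_nonneg hd hd₀ fun v hv => by
    have := deriv_nonneg_of_neg_imp (f := fun t : ℝ => r (y + t • v + t ^ 2 • (0 : E)))
      (f₀ := fun t : ℝ => r₀ (y + t • v + t ^ 2 • (0 : E))) (by simpa using h0) (by simpa using h00)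
      ((hp v 0).eventually h) (by rwa [hder hr₀])
    rwa [hder hr] at this
  refine ⟨c, hc, hcr, fun v hv => ?_⟩
  obtain ⟨ν', hν'⟩ : ∃ ν, fderiv ℝ r₀ y ν ≠ 0 := by
    by_contra! hc
    exact hd₀ (ContinuousLinearMap.ext hc)
  set ν := (fderiv ℝ r₀ y ν')⁻¹ • ν'
  have hν : fderiv ℝ r₀ y ν = 1 := by simp [ν, hν']
  refine le_of_forall_pos_le_add fun ε hε => ?_
  -- With bending `s ν` the second derivative of `r₀` along the parabola is `ε / c > 0`, just enough
  -- for the one-variable lemma. That of `r` is then `D²r(v, v) - c D²r₀(v, v) + ε`.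
  set s := -(fderiv ℝ (fderiv ℝ r₀) y v v) / 2 + ε / (2 * c)
  have := deriv_deriv_nonneg_of_neg_imp (hcont hr v (s • ν)) (hcont hr₀ v (s • ν))
    (by simpa using h0) (by simpa using h00) ((hp v (s • ν)).eventually h)
    (by rw [hder hr, hcr]; simp [hv]) (by rw [hder hr₀, hv])
    (by
      rw [deriv_deriv_comp_parabola hr₀, map_smul, hν]
      simp only [s, smul_eq_mul, mul_one]
      have : 0 < ε / (2 * c) := by positivity
      linarith)
  rw [deriv_deriv_comp_parabola hr, hcr] at this
  simp only [smul_apply, map_smul, hν, smul_eq_mul, mul_one, s] at this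
  have h3 : 2 * (c * (-(fderiv ℝ (fderiv ℝ r₀) y v v) / 2 + ε / (2 * c))) =
      - (c * fderiv ℝ (fderiv ℝ r₀) y v v) + ε := by
    field_simp
  rw [hcr] at *
  linarith

/-! ### Compactness of the space of orthonormal frames -/

theorem ContinuousLinearMap.isInvertible_of_posDef [FiniteDimensional ℝ E] {B : E →L[ℝ] E →L[ℝ] ℝ}
    (hB : ∀ v, v ≠ 0 → 0 < B v v) : B.IsInvertible := by
  have hinj : Function.Injective B := by
    refine (injective_iff_map_eq_zero B).2 fun v hv => ?_
    by_contra hne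
    have := hB v hne
    simp [hv] at this
  have hfin : Module.finrank ℝ E = Module.finrank ℝ (E →L[ℝ] ℝ) := by
    rw [← (LinearMap.toContinuousLinearMap (𝕜 := ℝ) (E := E) (F' := ℝ)).finrank_eq]
    exact (Subspace.dual_finrank_eq).symm
  refine ⟨(LinearEquiv.ofInjectiveOfFinrankEq (B : E →ₗ[ℝ] E →L[ℝ] ℝ) hinj hfin).toContinuousLinearEquiv, ?_⟩
  ext v w
  rfl

/-- The minimum of `g y₀` on the unit sphere gives the constant at `y₀`; half of it survives a small
perturbation in operator norm. The bound is uniform in `y`, which keeps orthonormal frames at nearby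
points in one compact ball. -/
theorem exists_pos_eventually_mul_sq_le [FiniteDimensional ℝ E] {g : E → E →L[ℝ] E →L[ℝ] ℝ} {y₀ : E}
    (hg : ContinuousAt g y₀) (hpos : ∀ v, v ≠ 0 → 0 < g y₀ v v) :
    ∃ c : ℝ, 0 < c ∧ ∀ᶠ y in 𝓝 y₀, ∀ v, c * ‖v‖ ^ 2 ≤ g y v v := by
  have hproper : ProperSpace E := FiniteDimensional.proper_real E
  obtain ⟨c, hc, hcv⟩ : ∃ c : ℝ, 0 < c ∧ ∀ v, c * ‖v‖ ^ 2 ≤ g y₀ v v := by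
    rcases subsingleton_or_nontrivial E with hE | hE
    · exact ⟨1, one_pos, fun v => by simp [Subsingleton.elim v 0]⟩
    obtain ⟨m, hm, hmin⟩ := (isCompact_sphere (0 : E) 1).exists_isMinOn
      (NormedSpace.sphere_nonempty.2 zero_le_one)
      (f := fun v => g y₀ v v) (by fun_prop)
    have hm0 : m ≠ 0 := fun h => by simp [h] at hm
    refine ⟨g y₀ m m, hpos m hm0, fun v => ?_⟩
    rcases eq_or_ne v 0 with rfl | hv
    · simp
    have h1 := hmin (show ‖v‖⁻¹ • v ∈ Metric.sphere (0 : E) 1 by simp [norm_smul, hv])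
    simp only [Set.mem_ofPred_eq, map_smul, smul_apply, smul_eq_mul] at h1
    have h2 : 0 < ‖v‖ := norm_pos_iff.2 hv
    calc g y₀ m m * ‖v‖ ^ 2 ≤ (‖v‖⁻¹ * (‖v‖⁻¹ * g y₀ v v)) * ‖v‖ ^ 2 := by gcongr
      _ = g y₀ v v := by field_simp
  refine ⟨c / 2, by positivity, ?_⟩
  have h1 : ∀ᶠ y in 𝓝 y₀, ‖g y - g y₀‖ < c / 2 := by
    have : ContinuousAt (fun y => ‖g y - g y₀‖) y₀ := (hg.sub continuousAt_const).norm
    exact this.eventually_lt_const (by simpa using hc)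
  filter_upwards [h1] with y hy v
  have h2 : |(g y - g y₀) v v| ≤ c / 2 * ‖v‖ ^ 2 := by
    calc |(g y - g y₀) v v| ≤ ‖g y - g y₀‖ * ‖v‖ * ‖v‖ := (g y - g y₀).le_opNorm₂ v v
      _ ≤ c / 2 * ‖v‖ * ‖v‖ := by gcongr
      _ = _ := by ring
  have h3 := (abs_le.1 h2).1
  simp only [sub_apply] at h3
  linarith [hcv v]

theorem Filter.Tendsto.clm_apply {α F G : Type*} [NormedAddCommGroup F] [NormedSpace ℝ F]
    [NormedAddCommGroup G] [NormedSpace ℝ G] {l : Filter α} {A : α → F →L[ℝ] G} {A₀ : F →L[ℝ] G}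
    {f : α → F} {f₀ : F} (hA : Tendsto A l (𝓝 A₀)) (hf : Tendsto f l (𝓝 f₀)) :
    Tendsto (fun n => A n (f n)) l (𝓝 (A₀ f₀)) :=
  (isBoundedBilinearMap_apply.continuous.tendsto (A₀, f₀)).comp (hA.prodMk_nhds hf)

/-- If the quadratic form `H y₀` has positive trace on every isotropic orthonormal frame at `y₀` that is
tangential to `{r = 0}`, then `H + (-r)⁻¹ dr ⊗ dr` has positive trace on every isotropic
orthonormal frame at the points of `{r < 0}` near `y₀`. -/
theorem eventually_sum_add_inv_mul_sq_pos [FiniteDimensional ℝ E] {ι : Type*}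
    [Fintype ι] [DecidableEq ι]
    {g β : E → E →L[ℝ] E →L[ℝ] ℝ} {r : E → ℝ} {dr : E → E →L[ℝ] ℝ} {H : E → E → ℝ} {y₀ : E}
    (hg : ContinuousAt g y₀) (hpos : ∀ v, v ≠ 0 → 0 < g y₀ v v) (hβ : ContinuousAt β y₀)
    (hr : ContinuousAt r y₀) (hr0 : r y₀ = 0) (hdr : ContinuousAt dr y₀)
    (hH : ∀ v, ContinuousAt (fun p : E × E => H p.1 p.2) (y₀, v))
    (hconv : ∀ a : ι → E, (∀ i j, g y₀ (a i) (a j) = if i = j then 1 else 0) →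
      (∀ i j, β y₀ (a i) (a j) = 0) → (∀ i, dr y₀ (a i) = 0) → 0 < ∑ i, H y₀ (a i)) :
    ∀ᶠ y in 𝓝 y₀, r y < 0 → ∀ a : ι → E, (∀ i j, g y (a i) (a j) = if i = j then 1 else 0) →
      (∀ i j, β y (a i) (a j) = 0) → 0 < ∑ i, (H y (a i) + (-r y)⁻¹ * dr y (a i) ^ 2) := by
  have hproper : ProperSpace E := FiniteDimensional.proper_real E
  by_contra hcon
  obtain ⟨c, hc, hcg⟩ := exists_pos_eventually_mul_sq_le hg hpos
  obtain ⟨y, hy, hP⟩ := exists_seq_forall_of_frequently ((not_eventually.1 hcon).and_eventually hcg)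
  have hP' (n : ℕ) : ∃ a : ι → E, r (y n) < 0 ∧ (∀ i j, g (y n) (a i) (a j) = if i = j then 1 else 0) ∧
      (∀ i j, β (y n) (a i) (a j) = 0) ∧
      ∑ i, (H (y n) (a i) + (-r (y n))⁻¹ * dr (y n) (a i) ^ 2) ≤ 0 := by
    have := (hP n).1
    push Not at this
    obtain ⟨h1, a, h2, h3, h4⟩ := this
    exact ⟨a, h1, h2, h3, h4⟩
  choose a hneg horth hiso hsum using hP'
  have hbdd (n : ℕ) : a n ∈ Metric.closedBall (0 : ι → E) (√(c⁻¹)) := by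
    rw [mem_closedBall_zero_iff, pi_norm_le_iff_of_nonneg (Real.sqrt_nonneg _)]
    intro i
    apply Real.le_sqrt_of_sq_le
    have := (hP n).2 (a n i)
    rw [horth, if_pos rfl] at this
    rw [← one_div, le_div_iff₀ hc]
    linarith
  obtain ⟨a₀, -, φ, hφ, hlim⟩ := (isCompact_closedBall (0 : ι → E) (√(c⁻¹))).tendsto_subseq hbdd
  have hyφ : Tendsto (fun n => y (φ n)) atTop (𝓝 y₀) := hy.comp hφ.tendsto_atTop
  have hai (i : ι) : Tendsto (fun n => a (φ n) i) atTop (𝓝 (a₀ i)) := (tendsto_pi_nhds.1 hlim) i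
  have hgφ : Tendsto (fun n => g (y (φ n))) atTop (𝓝 (g y₀)) := hg.tendsto.comp hyφ
  have hβφ : Tendsto (fun n => β (y (φ n))) atTop (𝓝 (β y₀)) := hβ.tendsto.comp hyφ
  have hdrφ : Tendsto (fun n => dr (y (φ n))) atTop (𝓝 (dr y₀)) := hdr.tendsto.comp hyφ
  have hgl (i j : ι) : g y₀ (a₀ i) (a₀ j) = if i = j then 1 else 0 := by
    refine tendsto_nhds_unique ((hgφ.clm_apply (hai i)).clm_apply (hai j)) ?_
    refine tendsto_const_nhds.congr fun n => ?_
    exact (horth (φ n) i j).symm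
  have hβl (i j : ι) : β y₀ (a₀ i) (a₀ j) = 0 := by
    refine tendsto_nhds_unique ((hβφ.clm_apply (hai i)).clm_apply (hai j)) ?_
    refine tendsto_const_nhds.congr fun n => ?_
    exact (hiso (φ n) i j).symm
  have hHl : Tendsto (fun n => ∑ i, H (y (φ n)) (a (φ n) i)) atTop (𝓝 (∑ i, H y₀ (a₀ i))) := by
    refine tendsto_finsetSum _ fun i _ => ?_
    exact (hH (a₀ i)).tendsto.comp (hyφ.prodMk_nhds (hai i))
  have hdrl (i : ι) : Tendsto (fun n => dr (y (φ n)) (a (φ n) i) ^ 2) atTop (𝓝 (dr y₀ (a₀ i) ^ 2)) :=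
    (hdrφ.clm_apply (hai i)).pow 2
  have hrl : Tendsto (fun n => r (y (φ n))) atTop (𝓝 0) := by
    rw [← hr0]
    exact hr.tendsto.comp hyφ
  have hsplit (n : ℕ) : ∑ i, H (y n) (a n i) + (-r (y n))⁻¹ * ∑ i, dr (y n) (a n i) ^ 2 ≤ 0 := by
    have := hsum n
    rwa [Finset.sum_add_distrib, ← Finset.mul_sum] at this
  -- The singular term is nonnegative where `r < 0`, so it can be dropped before passing to the
  -- limit.
  have hle : ∑ i, H y₀ (a₀ i) ≤ 0 := by
    refine le_of_tendsto' hHl fun n => ?_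
    have : 0 ≤ (-r (y (φ n)))⁻¹ * ∑ i, dr (y (φ n)) (a (φ n) i) ^ 2 :=
      mul_nonneg (inv_nonneg.2 (by linarith [hneg (φ n)])) (Finset.sum_nonneg fun _ _ => sq_nonneg _)
    linarith [hsplit (φ n)]
  -- Multiplying by `-r > 0` bounds the sum of squares by `r ∑ H`, which tends to 0 because `∑ H`
  -- converges.
  have hdr0 : ∑ i, dr y₀ (a₀ i) ^ 2 ≤ 0 := by
    have h1 : Tendsto (fun n => r (y (φ n)) * ∑ i, H (y (φ n)) (a (φ n) i)) atTop (𝓝 0) := by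
      simpa using hrl.mul hHl
    refine le_of_tendsto_of_tendsto' (tendsto_finsetSum _ fun i _ => hdrl i) h1 fun n => ?_
    have h2 := hsplit (φ n)
    have h3 : 0 < -r (y (φ n)) := by linarith [hneg (φ n)]
    have h4 := mul_le_mul_of_nonneg_left h2 h3.le
    rw [mul_add, ← mul_assoc, mul_inv_cancel₀ h3.ne', one_mul, mul_zero] at h4
    linarith
  have hdr1 (i : ι) : dr y₀ (a₀ i) = 0 := by
    have h1 := (Finset.sum_eq_zero_iff_of_nonneg (fun i _ => sq_nonneg (dr y₀ (a₀ i)))).1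
      (le_antisymm hdr0 (Finset.sum_nonneg fun _ _ => sq_nonneg _)) i (Finset.mem_univ i)
    exact pow_eq_zero_iff (two_ne_zero) |>.1 h1
  exact absurd (hconv a₀ hgl hβl hdr1) (not_lt.2 hle)

end Coordinates

section Charts

variable {E : Type*} [NormedAddCommGroup E] [NormedSpace ℝ E]
  {X : Type*} [TopologicalSpace X] [ChartedSpace E X]

/-! ### Bilinear forms and functions in charts -/

theorem formInChart_apply
    (B : (x : X) → TangentSpace 𝓘(ℝ, E) x →L[ℝ] TangentSpace 𝓘(ℝ, E) x →L[ℝ] ℝ)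
    (x₀ : X) (y a b : E) :
    formInChart B x₀ y a b = B ((extChartAt 𝓘(ℝ, E) x₀).symm y)
      (mfderiv 𝓘(ℝ, E) 𝓘(ℝ, E) (extChartAt 𝓘(ℝ, E) x₀).symm y a)
      (mfderiv 𝓘(ℝ, E) 𝓘(ℝ, E) (extChartAt 𝓘(ℝ, E) x₀).symm y b) := rfl

/-- The differential of a real function, as a linear form on the tangent space. -/
def differential (u : X → ℝ) (x : X) : TangentSpace 𝓘(ℝ, E) x →L[ℝ] ℝ := mfderiv 𝓘(ℝ, E) 𝓘(ℝ, ℝ) u x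

variable [IsManifold 𝓘(ℝ, E) ∞ X]

theorem contMDiffAt_extChartAt_of_mem {x₀ x : X} (hx : x ∈ (extChartAt 𝓘(ℝ, E) x₀).source) :
    ContMDiffAt 𝓘(ℝ, E) 𝓘(ℝ, E) ∞ (extChartAt 𝓘(ℝ, E) x₀) x :=
  contMDiffAt_extChartAt' (by simpa using hx)

theorem contMDiffAt_extChartAt_symm {x₀ : X} {y : E} (hy : y ∈ (extChartAt 𝓘(ℝ, E) x₀).target) :
    ContMDiffAt 𝓘(ℝ, E) 𝓘(ℝ, E) ∞ (extChartAt 𝓘(ℝ, E) x₀).symm y :=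
  (contMDiffOn_extChartAt_symm x₀).contMDiffAt ((isOpen_extChartAt_target x₀).mem_nhds hy)

theorem mfderiv_extChartAt_symm_apply {x₀ x : X} (hx : x ∈ (extChartAt 𝓘(ℝ, E) x₀).source) (v : E) :
    (mfderiv 𝓘(ℝ, E) 𝓘(ℝ, E) (extChartAt 𝓘(ℝ, E) x₀).symm (extChartAt 𝓘(ℝ, E) x₀ x)
      (mfderiv 𝓘(ℝ, E) 𝓘(ℝ, E) (extChartAt 𝓘(ℝ, E) x₀) x v : E) : E) = v := by
  have : IsManifold 𝓘(ℝ, E) 1 X := IsManifold.of_le (n := ∞) (by simp)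
  have := mfderivWithin_extChartAt_symm_comp_mfderiv_extChartAt' (I := 𝓘(ℝ, E)) hx
  rw [ModelWithCorners.range_eq_univ, mfderivWithin_univ] at this
  exact DFunLike.congr_fun this v

theorem mfderiv_extChartAt_apply_symm {x₀ x : X} (hx : x ∈ (extChartAt 𝓘(ℝ, E) x₀).source) (v : E) :
    (mfderiv 𝓘(ℝ, E) 𝓘(ℝ, E) (extChartAt 𝓘(ℝ, E) x₀) x
      (mfderiv 𝓘(ℝ, E) 𝓘(ℝ, E) (extChartAt 𝓘(ℝ, E) x₀).symm (extChartAt 𝓘(ℝ, E) x₀ x) v : E) : E) = v := by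
  have : IsManifold 𝓘(ℝ, E) 1 X := IsManifold.of_le (n := ∞) (by simp)
  have := mfderiv_extChartAt_comp_mfderivWithin_extChartAt_symm' (I := 𝓘(ℝ, E)) hx
  rw [ModelWithCorners.range_eq_univ, mfderivWithin_univ] at this
  exact DFunLike.congr_fun this v

theorem formInChart_extChartAt
    (B : (x : X) → TangentSpace 𝓘(ℝ, E) x →L[ℝ] TangentSpace 𝓘(ℝ, E) x →L[ℝ] ℝ)
    {x₀ x : X} (hx : x ∈ (extChartAt 𝓘(ℝ, E) x₀).source) (v w : TangentSpace 𝓘(ℝ, E) x) :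
    formInChart B x₀ (extChartAt 𝓘(ℝ, E) x₀ x) (mfderiv 𝓘(ℝ, E) 𝓘(ℝ, E) (extChartAt 𝓘(ℝ, E) x₀) x v)
      (mfderiv 𝓘(ℝ, E) 𝓘(ℝ, E) (extChartAt 𝓘(ℝ, E) x₀) x w) = B x v w := by
  -- The base point `φ.symm (φ x)` equals `x` only propositionally, and the tangent spaces depend on
  -- it; a free variable `p` makes substitution possible.
  have key (p : X) (hp : p = x) (a b : E) (ha : a = v) (hb : b = w) : B p a b = B x v w := by
    subst hp ha hb
    rfl
  exact key _ ((extChartAt 𝓘(ℝ, E) x₀).left_inv hx) _ _ (mfderiv_extChartAt_symm_apply hx v)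
    (mfderiv_extChartAt_symm_apply hx w)

/-- Coordinate vector fields are smooth, being images of constant sections under the tangent map of
the inverse chart. Evaluating a bundle section on them gives its smooth coefficients. -/
theorem contMDiffOn_mfderiv_extChartAt_symm (x₀ : X) (a : E) :
    ContMDiffOn 𝓘(ℝ, E) (𝓘(ℝ, E).prod 𝓘(ℝ, E)) ∞
      (fun y => (Bundle.TotalSpace.mk' E (E := (TangentSpace 𝓘(ℝ, E) : X → Type _))
        ((extChartAt 𝓘(ℝ, E) x₀).symm y)
        (mfderiv 𝓘(ℝ, E) 𝓘(ℝ, E) (extChartAt 𝓘(ℝ, E) x₀).symm y a)))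
      (extChartAt 𝓘(ℝ, E) x₀).target := by
  have hopen := isOpen_extChartAt_target (I := 𝓘(ℝ, E)) x₀
  have h1 := (contMDiffOn_extChartAt_symm (I := 𝓘(ℝ, E)) (n := ∞) x₀).contMDiffOn_tangentMapWithin
    (m := ∞) (by simp) hopen.uniqueMDiffOn
  have h2 : ContMDiff 𝓘(ℝ, E) (𝓘(ℝ, E).prod 𝓘(ℝ, E)) ∞
      (fun y : E => (Bundle.TotalSpace.mk' E (E := (TangentSpace 𝓘(ℝ, E) : E → Type _)) y a)) :=
    contMDiff_vectorSpace_iff_contDiff.2 contDiff_const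
  refine (h1.comp (h2.contMDiffOn (s := (extChartAt 𝓘(ℝ, E) x₀).target)) fun y hy => hy).congr
    fun y hy => ?_
  simp only [Function.comp, tangentMapWithin]
  rw [mfderivWithin_of_isOpen hopen hy]

theorem contDiffOn_formInChart [FiniteDimensional ℝ E]
    {B : (x : X) → TangentSpace 𝓘(ℝ, E) x →L[ℝ] TangentSpace 𝓘(ℝ, E) x →L[ℝ] ℝ}
    (hB : ContMDiff 𝓘(ℝ, E) (𝓘(ℝ, E).prod 𝓘(ℝ, E →L[ℝ] E →L[ℝ] ℝ)) ∞
      (fun x => Bundle.TotalSpace.mk' (E →L[ℝ] E →L[ℝ] ℝ)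
        (E := fun x : X => TangentSpace 𝓘(ℝ, E) x →L[ℝ] TangentSpace 𝓘(ℝ, E) x →L[ℝ] ℝ) x (B x)))
    (x₀ : X) : ContDiffOn ℝ ∞ (formInChart B x₀) (extChartAt 𝓘(ℝ, E) x₀).target := by
  rw [contDiffOn_clm_apply]
  intro a
  rw [contDiffOn_clm_apply]
  intro b
  have h1 := hB.comp_contMDiffOn (contMDiffOn_extChartAt_symm (I := 𝓘(ℝ, E)) (n := ∞) x₀)
  have h2 := ContMDiffOn.clm_bundle_apply₂ (E₃ := Bundle.Trivial X ℝ) (F₃ := ℝ) h1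
    (contMDiffOn_mfderiv_extChartAt_symm x₀ a) (contMDiffOn_mfderiv_extChartAt_symm x₀ b)
  intro y hy
  have h3 := (Bundle.contMDiffWithinAt_totalSpace.1 (h2 y hy)).2
  exact h3.contDiffWithinAt

theorem contDiffAt_transition {x₀ x : X} (hx : x ∈ (extChartAt 𝓘(ℝ, E) x₀).source) :
    ContDiffAt ℝ ∞ (extChartAt 𝓘(ℝ, E) x₀ ∘ (extChartAt 𝓘(ℝ, E) x).symm) (extChartAt 𝓘(ℝ, E) x x) := by
  rw [← contMDiffAt_iff_contDiffAt]
  have h := (extChartAt 𝓘(ℝ, E) x).left_inv (mem_extChartAt_source x)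
  exact ContMDiffAt.comp_of_eq (contMDiffAt_extChartAt_of_mem hx)
    (contMDiffAt_extChartAt_symm (mem_extChartAt_target x)) h

theorem eventually_extChartAt_symm_mem {x₀ x : X} (hx : x ∈ (extChartAt 𝓘(ℝ, E) x₀).source) :
    ∀ᶠ z in 𝓝 (extChartAt 𝓘(ℝ, E) x x), z ∈ (extChartAt 𝓘(ℝ, E) x).target ∧
      (extChartAt 𝓘(ℝ, E) x).symm z ∈ (extChartAt 𝓘(ℝ, E) x₀).source := by
  have h := (extChartAt 𝓘(ℝ, E) x).left_inv (mem_extChartAt_source x)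
  refine ((isOpen_extChartAt_target x).eventually_mem (mem_extChartAt_target x)).and ?_
  have hc := (contMDiffAt_extChartAt_symm (mem_extChartAt_target (I := 𝓘(ℝ, E)) x)).continuousAt
  refine hc.eventually ?_
  rw [h]
  exact (isOpen_extChartAt_source x₀).mem_nhds hx

theorem formInChart_transition
    (B : (x : X) → TangentSpace 𝓘(ℝ, E) x →L[ℝ] TangentSpace 𝓘(ℝ, E) x →L[ℝ] ℝ)
    {x₀ x : X} {z : E} (hz : z ∈ (extChartAt 𝓘(ℝ, E) x).target)
    (hz' : (extChartAt 𝓘(ℝ, E) x).symm z ∈ (extChartAt 𝓘(ℝ, E) x₀).source) (a b : E) :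
    formInChart B x z a b =
      formInChart B x₀ ((extChartAt 𝓘(ℝ, E) x₀ ∘ (extChartAt 𝓘(ℝ, E) x).symm) z)
        (fderiv ℝ (extChartAt 𝓘(ℝ, E) x₀ ∘ (extChartAt 𝓘(ℝ, E) x).symm) z a)
        (fderiv ℝ (extChartAt 𝓘(ℝ, E) x₀ ∘ (extChartAt 𝓘(ℝ, E) x).symm) z b) := by
  have hd : fderiv ℝ (extChartAt 𝓘(ℝ, E) x₀ ∘ (extChartAt 𝓘(ℝ, E) x).symm) z =
      (mfderiv 𝓘(ℝ, E) 𝓘(ℝ, E) (extChartAt 𝓘(ℝ, E) x₀) ((extChartAt 𝓘(ℝ, E) x).symm z)).comp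
        (mfderiv 𝓘(ℝ, E) 𝓘(ℝ, E) (extChartAt 𝓘(ℝ, E) x).symm z) := by
    rw [← mfderiv_eq_fderiv]
    exact mfderiv_comp z ((contMDiffAt_extChartAt_of_mem hz').mdifferentiableAt (by simp))
      ((contMDiffAt_extChartAt_symm hz).mdifferentiableAt (by simp))
  rw [hd, formInChart_apply]
  exact (formInChart_extChartAt B hz' _ _).symm

theorem fderiv_transition_apply {x₀ x : X} (hx : x ∈ (extChartAt 𝓘(ℝ, E) x₀).source) (v : E) :
    fderiv ℝ (extChartAt 𝓘(ℝ, E) x₀ ∘ (extChartAt 𝓘(ℝ, E) x).symm) (extChartAt 𝓘(ℝ, E) x x)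
      (mfderiv 𝓘(ℝ, E) 𝓘(ℝ, E) (extChartAt 𝓘(ℝ, E) x) x v : E) =
    (mfderiv 𝓘(ℝ, E) 𝓘(ℝ, E) (extChartAt 𝓘(ℝ, E) x₀) x v : E) := by
  have h1 : extChartAt 𝓘(ℝ, E) x₀ =ᶠ[𝓝 x]
      (extChartAt 𝓘(ℝ, E) x₀ ∘ (extChartAt 𝓘(ℝ, E) x).symm) ∘ extChartAt 𝓘(ℝ, E) x := by
    filter_upwards [extChartAt_source_mem_nhds (I := 𝓘(ℝ, E)) x] with z hz
    simp only [Function.comp_apply, (extChartAt 𝓘(ℝ, E) x).left_inv hz]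
  have h2 := mfderiv_comp (I := 𝓘(ℝ, E)) (I' := 𝓘(ℝ, E)) (I'' := 𝓘(ℝ, E)) x
    ((contDiffAt_transition hx).contMDiffAt.mdifferentiableAt (by simp))
    ((contMDiffAt_extChartAt_of_mem (mem_extChartAt_source x)).mdifferentiableAt (by simp))
  rw [h1.mfderiv_eq, h2, mfderiv_eq_fderiv]
  rfl

theorem contDiffAt_comp_extChartAt_symm {n : ℕ∞} {u : X → ℝ} {x₀ x : X}
    (hx : x ∈ (extChartAt 𝓘(ℝ, E) x₀).source) (hu : ContMDiffAt 𝓘(ℝ, E) 𝓘(ℝ, ℝ) n u x) :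
    ContDiffAt ℝ n (u ∘ (extChartAt 𝓘(ℝ, E) x₀).symm) (extChartAt 𝓘(ℝ, E) x₀ x) := by
  rw [← contMDiffAt_iff_contDiffAt]
  exact ContMDiffAt.comp_of_eq hu ((contMDiffAt_extChartAt_symm
    ((extChartAt 𝓘(ℝ, E) x₀).map_source hx)).of_le (by exact_mod_cast le_top))
    ((extChartAt 𝓘(ℝ, E) x₀).left_inv hx)

theorem fderiv_comp_extChartAt_symm_apply {u : X → ℝ} {x₀ x : X}
    (hx : x ∈ (extChartAt 𝓘(ℝ, E) x₀).source) (hu : ContMDiffAt 𝓘(ℝ, E) 𝓘(ℝ, ℝ) 1 u x) (v : E) :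
    fderiv ℝ (u ∘ (extChartAt 𝓘(ℝ, E) x₀).symm) (extChartAt 𝓘(ℝ, E) x₀ x)
      (mfderiv 𝓘(ℝ, E) 𝓘(ℝ, E) (extChartAt 𝓘(ℝ, E) x₀) x v : E) =
    differential u x v := by
  unfold differential
  have h1 : u =ᶠ[𝓝 x] (u ∘ (extChartAt 𝓘(ℝ, E) x₀).symm) ∘ extChartAt 𝓘(ℝ, E) x₀ := by
    filter_upwards [(isOpen_extChartAt_source (I := 𝓘(ℝ, E)) x₀).mem_nhds hx] with z hz
    simp only [Function.comp_apply, (extChartAt 𝓘(ℝ, E) x₀).left_inv hz]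
  have h2 := mfderiv_comp (I := 𝓘(ℝ, E)) (I' := 𝓘(ℝ, E)) (I'' := 𝓘(ℝ, ℝ)) x
    ((contDiffAt_comp_extChartAt_symm (n := 1) hx hu).contMDiffAt.mdifferentiableAt (by simp))
    ((contMDiffAt_extChartAt_of_mem hx).mdifferentiableAt (by simp))
  rw [h1.mfderiv_eq, h2, mfderiv_eq_fderiv]
  rfl

end Charts

/-! ### The metric and the hessian on the manifold -/

namespace GromovStructure

variable {E : Type*} [NormedAddCommGroup E] [NormedSpace ℝ E] [FiniteDimensional ℝ E]
  {X : Type*} [TopologicalSpace X] [ChartedSpace E X] [IsManifold 𝓘(ℝ, E) ∞ X]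
  (G : GromovStructure E X)

omit [FiniteDimensional ℝ E] in
theorem metric_apply (x : X) (v w : TangentSpace 𝓘(ℝ, E) x) :
    G.metric x v w = G.form x (G.J x v) w := rfl

omit [FiniteDimensional ℝ E] in
-- Follows from `ω(Jv, w) = ω(JJv, Jw) = -ω(v, Jw) = ω(Jw, v)`.
theorem metric_symm (x : X) (v w : TangentSpace 𝓘(ℝ, E) x) : G.metric x v w = G.metric x w v := by
  have hanti (a b : TangentSpace 𝓘(ℝ, E) x) : G.form x a b = - G.form x b a := by
    have := G.form_self x (a + b)
    simp only [map_add, add_apply, G.form_self] at this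
    linarith
  rw [metric_apply, metric_apply, ← G.form_J_J x (G.J x v) w, G.J_J, map_neg,
    neg_apply, hanti v]
  ring

omit [FiniteDimensional ℝ E] in
theorem metric_pos (x : X) {v : TangentSpace 𝓘(ℝ, E) x} (hv : v ≠ 0) : 0 < G.metric x v v :=
  G.form_J_pos x v hv

theorem contDiffOn_metric (x₀ : X) :
    ContDiffOn ℝ ∞ (formInChart G.metric x₀) (extChartAt 𝓘(ℝ, E) x₀).target := by
  rw [contDiffOn_clm_apply]
  intro a
  rw [contDiffOn_clm_apply]
  intro b
  have h1 := G.contMDiff_form.comp_contMDiffOn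
    (contMDiffOn_extChartAt_symm (I := 𝓘(ℝ, E)) (n := ∞) x₀)
  have hJ := G.contMDiff_J.comp_contMDiffOn
    (contMDiffOn_extChartAt_symm (I := 𝓘(ℝ, E)) (n := ∞) x₀)
  have h2 := ContMDiffOn.clm_bundle_apply₂ (E₃ := Bundle.Trivial X ℝ) (F₃ := ℝ) h1
    (ContMDiffOn.clm_bundle_apply hJ (contMDiffOn_mfderiv_extChartAt_symm x₀ a))
    (contMDiffOn_mfderiv_extChartAt_symm x₀ b)
  intro y hy
  have h3 := (Bundle.contMDiffWithinAt_totalSpace.1 (h2 y hy)).2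
  exact h3.contDiffWithinAt

theorem contDiffAt_metric {x₀ x : X} (hx : x ∈ (extChartAt 𝓘(ℝ, E) x₀).source) :
    ContDiffAt ℝ ∞ (formInChart G.metric x₀) (extChartAt 𝓘(ℝ, E) x₀ x) :=
  (G.contDiffOn_metric x₀).contDiffAt ((isOpen_extChartAt_target x₀).mem_nhds
    ((extChartAt 𝓘(ℝ, E) x₀).map_source hx))

omit [FiniteDimensional ℝ E] in
theorem formInChart_metric_symm (x₀ : X) (y a b : E) :
    formInChart G.metric x₀ y a b = formInChart G.metric x₀ y b a :=
  G.metric_symm _ _ _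

omit [FiniteDimensional ℝ E] in
theorem formInChart_metric_pos {x₀ x : X} (hx : x ∈ (extChartAt 𝓘(ℝ, E) x₀).source) {a : E}
    (ha : a ≠ 0) : 0 < formInChart G.metric x₀ (extChartAt 𝓘(ℝ, E) x₀ x) a a := by
  refine G.metric_pos _ fun h => ha ?_
  rw [← mfderiv_extChartAt_apply_symm hx a]
  have h' : (mfderiv 𝓘(ℝ, E) 𝓘(ℝ, E) (extChartAt 𝓘(ℝ, E) x₀).symm (extChartAt 𝓘(ℝ, E) x₀ x) a : E) = 0 := h
  rw [h']
  exact map_zero (mfderiv 𝓘(ℝ, E) 𝓘(ℝ, E) (extChartAt 𝓘(ℝ, E) x₀) x)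

theorem isInvertible_formInChart_metric {x₀ x : X} (hx : x ∈ (extChartAt 𝓘(ℝ, E) x₀).source) :
    (formInChart G.metric x₀ (extChartAt 𝓘(ℝ, E) x₀ x)).IsInvertible :=
  ContinuousLinearMap.isInvertible_of_posDef fun _ ha => G.formInChart_metric_pos hx ha

/-- The hessian can be computed in any chart. -/
theorem hess_eq_coordHess {u : X → ℝ} {x₀ x : X} (hx : x ∈ (extChartAt 𝓘(ℝ, E) x₀).source)
    (hu : ContMDiffAt 𝓘(ℝ, E) 𝓘(ℝ, ℝ) 2 u x) (v w : TangentSpace 𝓘(ℝ, E) x) :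
    G.hess u x v w = coordHess (formInChart G.metric x₀) (u ∘ (extChartAt 𝓘(ℝ, E) x₀).symm)
      (extChartAt 𝓘(ℝ, E) x₀ x) (mfderiv 𝓘(ℝ, E) 𝓘(ℝ, E) (extChartAt 𝓘(ℝ, E) x₀) x v)
      (mfderiv 𝓘(ℝ, E) 𝓘(ℝ, E) (extChartAt 𝓘(ℝ, E) x₀) x w) := by
  have hxx := mem_extChartAt_source (I := 𝓘(ℝ, E)) x
  have hψ : (extChartAt 𝓘(ℝ, E) x₀ ∘ (extChartAt 𝓘(ℝ, E) x).symm) (extChartAt 𝓘(ℝ, E) x x) =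
      extChartAt 𝓘(ℝ, E) x₀ x := by
    simp
  have hsurj : Function.Surjective (fderiv ℝ
      (extChartAt 𝓘(ℝ, E) x₀ ∘ (extChartAt 𝓘(ℝ, E) x).symm) (extChartAt 𝓘(ℝ, E) x x)) := by
    intro a
    refine ⟨(mfderiv 𝓘(ℝ, E) 𝓘(ℝ, E) (extChartAt 𝓘(ℝ, E) x) x
      (mfderiv 𝓘(ℝ, E) 𝓘(ℝ, E) (extChartAt 𝓘(ℝ, E) x₀).symm (extChartAt 𝓘(ℝ, E) x₀ x) a : E) : E), ?_⟩
    exact (fderiv_transition_apply hx _).trans (mfderiv_extChartAt_apply_symm hx a)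
  have h := coordHess_pullback (g := formInChart G.metric x₀) (g' := formInChart G.metric x)
    (u := u ∘ (extChartAt 𝓘(ℝ, E) x₀).symm) (u' := u ∘ (extChartAt 𝓘(ℝ, E) x).symm)
    ((contDiffAt_transition hx).of_le (WithTop.coe_le_coe.2 le_top)) hsurj
    ((eventually_extChartAt_symm_mem hx).mono fun z hz a b =>
      formInChart_transition G.metric hz.1 hz.2 a b)
    (by rw [hψ]; exact (G.contDiffAt_metric hx).differentiableAt (by simp))
    ((G.contDiffAt_metric hxx).differentiableAt (by simp))
    (fun a b => G.formInChart_metric_symm _ _ a b)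
    (by rw [hψ]; exact G.isInvertible_formInChart_metric hx)
    (G.isInvertible_formInChart_metric hxx)
    (by rw [hψ]; exact contDiffAt_comp_extChartAt_symm (n := 2) hx hu)
    ((eventually_extChartAt_symm_mem hx).mono fun z hz => by
      simp only [Function.comp_apply, (extChartAt 𝓘(ℝ, E) x₀).left_inv hz.2])
    (mfderiv 𝓘(ℝ, E) 𝓘(ℝ, E) (extChartAt 𝓘(ℝ, E) x) x v)
    (mfderiv 𝓘(ℝ, E) 𝓘(ℝ, E) (extChartAt 𝓘(ℝ, E) x) x w)
  rw [hψ] at h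
  refine h.trans ?_
  congr 1
  · exact fderiv_transition_apply hx v
  · exact fderiv_transition_apply hx w

omit [FiniteDimensional ℝ E] in
theorem hess_real_comp {u : X → ℝ} {χ : ℝ → ℝ} {x : X} (hu : ContMDiffAt 𝓘(ℝ, E) 𝓘(ℝ, ℝ) 2 u x)
    (hχ : ContDiffAt ℝ 2 χ (u x)) (v w : TangentSpace 𝓘(ℝ, E) x) :
    G.hess (fun z => χ (u z)) x v w = deriv χ (u x) * G.hess u x v w + deriv (deriv χ) (u x) *
      (differential u x v * differential u x w) := by
  have hxx := mem_extChartAt_source (I := 𝓘(ℝ, E)) x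
  have hval : (u ∘ (extChartAt 𝓘(ℝ, E) x).symm) (extChartAt 𝓘(ℝ, E) x x) = u x := by simp
  have h := coordHess_real_comp (g := formInChart G.metric x)
    (contDiffAt_comp_extChartAt_symm (n := 2) hxx hu) (χ := χ) (by rwa [hval])
    (mfderiv 𝓘(ℝ, E) 𝓘(ℝ, E) (extChartAt 𝓘(ℝ, E) x) x v)
    (mfderiv 𝓘(ℝ, E) 𝓘(ℝ, E) (extChartAt 𝓘(ℝ, E) x) x w)
  have hu1 : ContMDiffAt 𝓘(ℝ, E) 𝓘(ℝ, ℝ) 1 u x := hu.of_le (by norm_num)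
  have e1 := fderiv_comp_extChartAt_symm_apply hxx hu1 v
  have e2 := fderiv_comp_extChartAt_symm_apply hxx hu1 w
  rw [hval] at h
  refine h.trans ?_
  congr 2
  exact congrArg₂ (· * ·) e1 e2

omit [FiniteDimensional ℝ E] in
theorem hess_congr {u u' : X → ℝ} {x : X} (h : u =ᶠ[𝓝 x] u') : G.hess u x = G.hess u' x := by
  have hxx := mem_extChartAt_source (I := 𝓘(ℝ, E)) x
  have hc := (contMDiffAt_extChartAt_symm (mem_extChartAt_target (I := 𝓘(ℝ, E)) x)).continuousAt.tendsto
  rw [(extChartAt 𝓘(ℝ, E) x).left_inv hxx] at hc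
  have := coordHess_congr (g := formInChart G.metric x) (h.comp_tendsto hc)
  funext v w
  exact congrFun₂ this _ _

/-! ### Traces in orthonormal bases -/

theorem exists_orthonormal_basis (x : X) (W : Submodule ℝ (TangentSpace 𝓘(ℝ, E) x)) :
    ∃ e : Module.Basis (Fin (Module.finrank ℝ W)) ℝ W,
      ∀ i j, G.metric x (e i) (e j) = if i = j then 1 else 0 := by
  let B : LinearMap.BilinForm ℝ W := LinearMap.mk₂ ℝ (fun v w : W => G.metric x v w)
    (by intros; simp) (by intros; simp) (by intros; simp) (by intros; simp)
  have hB (v w : W) : B v w = G.metric x v w := rfl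
  obtain ⟨b, hb⟩ := LinearMap.BilinForm.exists_orthogonal_basis (B := B)
    ⟨fun v w => G.metric_symm x v w⟩
  have hpos (i) : 0 < G.metric x (b i) (b i) :=
    G.metric_pos x fun h => b.ne_zero i (Subtype.ext h)
  have hu (i) : IsUnit (√(G.metric x (b i) (b i)))⁻¹ :=
    (inv_pos.2 (Real.sqrt_pos.2 (hpos i))).ne'.isUnit
  refine ⟨b.isUnitSMul hu, fun i j => ?_⟩
  simp only [Module.Basis.isUnitSMul_apply, Submodule.coe_smul, map_smul, smul_apply,
    smul_eq_mul]
  split_ifs with hij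
  · subst hij
    have h1 := Real.mul_self_sqrt (hpos i).le
    have h2 := (Real.sqrt_pos.2 (hpos i)).ne'
    field_simp
    rw [sq, h1]
  · have : G.metric x (b i) (b j) = 0 := hb hij
    simp [this]

theorem hessTrace_eq_sum (u : X → ℝ) (x : X) (W : Submodule ℝ (TangentSpace 𝓘(ℝ, E) x)) {ι : Type*}
    [Fintype ι] [DecidableEq ι] (e : Module.Basis ι ℝ W)
    (he : ∀ i j, G.metric x (e i) (e j) = if i = j then 1 else 0) :
    G.hessTrace u x W = ∑ i, G.hess u x (e i) (e i) := by
  let B : LinearMap.BilinForm ℝ (TangentSpace 𝓘(ℝ, E) x) :=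
    LinearMap.mk₂ ℝ (fun v w => G.metric x v w)
      (by intros; simp) (by intros; simp) (by intros; simp) (by intros; simp)
  let H : LinearMap.BilinForm ℝ (TangentSpace 𝓘(ℝ, E) x) :=
    LinearMap.mk₂ ℝ (fun v w => G.hess u x v w)
      (fun v v' w => by
        unfold hess
        simp only [map_add]
        exact coordHess_add_left _ _ _ _ _ _)
      (fun c v w => by
        unfold hess
        simp only [map_smul]
        exact coordHess_smul_left _ _ _ _ _ _)
      (fun v w w' => by
        unfold hess
        simp only [map_add]
        exact coordHess_add_right _ _ _ _ _ _)
      (fun c v w => by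
        unfold hess
        simp only [map_smul]
        exact coordHess_smul_right _ _ _ _ _ _)
  exact traceOn_eq_sum B H W e he

end GromovStructure

/-! ### Defining functions and their logarithms -/

namespace IsDefiningFunction

variable {E : Type*} [NormedAddCommGroup E] [NormedSpace ℝ E]
  {X : Type*} [TopologicalSpace X] [ChartedSpace E X] {ρ : X → ℝ} {Ω : Set X}

theorem contMDiffAt (h : IsDefiningFunction E ρ Ω) {x : X} (hx : x ∈ closure Ω) :
    ContMDiffAt 𝓘(ℝ, E) 𝓘(ℝ, ℝ) ∞ ρ x := by
  obtain ⟨U, hU, hΩU, hρ, -⟩ := h.exists_nhds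
  exact hρ.contMDiffAt (hU.mem_nhds (hΩU hx))

theorem neg (h : IsDefiningFunction E ρ Ω) {x : X} (hx : x ∈ Ω) : ρ x < 0 := by
  obtain ⟨U, -, -, -, hΩ⟩ := h.exists_nhds
  rw [hΩ] at hx
  exact hx.2

theorem eventually_mem_iff (h : IsDefiningFunction E ρ Ω) {x : X} (hx : x ∈ closure Ω) :
    ∀ᶠ z in 𝓝 x, z ∈ Ω ↔ ρ z < 0 := by
  obtain ⟨U, hU, hΩU, -, hΩ⟩ := h.exists_nhds
  filter_upwards [hU.mem_nhds (hΩU hx)] with z hz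
  refine ⟨h.neg, fun hρ => ?_⟩
  rw [hΩ]
  exact ⟨hz, hρ⟩

theorem eq_zero (h : IsDefiningFunction E ρ Ω) (hΩ : IsOpen Ω) {x : X} (hx : x ∈ frontier Ω) :
    ρ x = 0 := by
  have hxc := frontier_subset_closure hx
  have hxΩ : x ∉ Ω := fun hxΩ => hx.2 (hΩ.interior_eq.symm ▸ hxΩ)
  refine le_antisymm ?_ ?_
  · have := mem_closure_iff_frequently.1 hxc
    exact le_of_tendsto_of_frequently (h.contMDiffAt hxc).continuousAt
      (this.mono fun z hz => (h.neg hz).le)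
  · by_contra! hlt
    exact hxΩ ((h.eventually_mem_iff hxc).self_of_nhds.2 hlt)

/-- Sublevel sets of `-log(-ρ)` in `Ω` are compact. -/
theorem isCompact_sublevel (h : IsDefiningFunction E ρ Ω) (hΩc : IsCompact (closure Ω)) (c : ℝ) : IsCompact {x ∈ Ω | -Real.log (-ρ x) ≤ c} := by
  have heq : {x ∈ Ω | -Real.log (-ρ x) ≤ c} = closure Ω ∩ ρ ⁻¹' Set.Iic (-Real.exp (-c)) := by
    ext x
    constructor
    · rintro ⟨hx, hxc⟩
      refine ⟨subset_closure hx, ?_⟩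
      have h1 := (Real.le_log_iff_exp_le (neg_pos.2 (h.neg hx))).1 (neg_le.1 hxc)
      exact le_neg.1 h1
    · rintro ⟨hx, hxc⟩
      have h2 : ρ x ≤ -Real.exp (-c) := hxc
      have h1 : ρ x < 0 := by linarith [Real.exp_pos (-c)]
      refine ⟨(h.eventually_mem_iff hx).self_of_nhds.2 h1, ?_⟩
      exact neg_le.1 ((Real.le_log_iff_exp_le (neg_pos.2 h1)).2 (le_neg.1 h2))
  have hcont : ContinuousOn ρ (closure Ω) := fun x hx =>
    (h.contMDiffAt hx).continuousAt.continuousWithinAt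
  rw [heq]
  exact hΩc.of_isClosed_subset (hcont.preimage_isClosed_of_isClosed isClosed_closure isClosed_Iic)
    Set.inter_subset_left

theorem contMDiffAt_neg_log (h : IsDefiningFunction E ρ Ω) {x : X} (hx : x ∈ Ω) :
    ContMDiffAt 𝓘(ℝ, E) 𝓘(ℝ, ℝ) ∞ (fun x => -Real.log (-ρ x)) x := by
  have hlog : ContDiffAt ℝ ∞ (fun t : ℝ => -Real.log (-t)) (ρ x) :=
    ((contDiffAt_id.neg).log (neg_ne_zero.2 (h.neg hx).ne)).neg
  exact hlog.contMDiffAt.comp x (h.contMDiffAt (subset_closure hx))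

end IsDefiningFunction

theorem hasDerivAt_neg_log_neg {t : ℝ} (ht : t < 0) :
    HasDerivAt (fun s : ℝ => -Real.log (-s)) (-t)⁻¹ t := by
  have := ((hasDerivAt_neg t).log (neg_ne_zero.2 ht.ne)).neg
  refine this.congr_deriv ?_
  rw [neg_div, neg_neg, one_div]

theorem deriv_deriv_neg_log_neg {t : ℝ} (ht : t < 0) :
    deriv (deriv fun s : ℝ => -Real.log (-s)) t = (-t)⁻¹ ^ 2 := by
  have h : deriv (fun s : ℝ => -Real.log (-s)) =ᶠ[𝓝 t] fun s => (-s)⁻¹ := by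
    filter_upwards [Iio_mem_nhds ht] with s hs using (hasDerivAt_neg_log_neg hs).deriv
  rw [h.deriv_eq, ((hasDerivAt_neg t).fun_inv (neg_ne_zero.2 ht.ne)).deriv]
  field_simp

theorem coordHess_const {E : Type*} [NormedAddCommGroup E] [NormedSpace ℝ E]
    (g : E → E →L[ℝ] E →L[ℝ] ℝ) (c : ℝ) (y v w : E) : coordHess g (fun _ => c) y v w = 0 := by
  have h : fderiv ℝ (fun _ : E => c) = fun _ => 0 := funext fun z => fderiv_const_apply c
  simp only [coordHess, h, fderiv_const_apply]
  simp

/-! ### A convex increasing function that vanishes on a half line -/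

/-- The smooth function `t exp(-1/t)`, extended by zero to `t ≤ 0`. -/
def convexGlue (t : ℝ) : ℝ := t * expNegInvGlue t

theorem contDiff_convexGlue : ContDiff ℝ ∞ convexGlue :=
  contDiff_id.mul expNegInvGlue.contDiff

theorem convexGlue_of_nonpos {t : ℝ} (ht : t ≤ 0) : convexGlue t = 0 := by
  simp [convexGlue, expNegInvGlue.zero_of_nonpos ht]

theorem hasDerivAt_convexGlue {t : ℝ} (ht : 0 < t) :
    HasDerivAt convexGlue (Real.exp (-t⁻¹) * (1 + t⁻¹)) t := by
  have h : convexGlue =ᶠ[𝓝 t] fun s => s * Real.exp (-s⁻¹) := by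
    filter_upwards [Ioi_mem_nhds ht] with s hs
    simp [convexGlue, expNegInvGlue, not_le.2 (show 0 < s from hs)]
  have h1 := (hasDerivAt_id' t).fun_mul ((hasDerivAt_inv ht.ne').fun_neg.exp)
  refine (h1.congr_deriv ?_).congr_of_eventuallyEq h
  field_simp

theorem deriv_convexGlue_pos {t : ℝ} (ht : 0 < t) : 0 < deriv convexGlue t := by
  rw [(hasDerivAt_convexGlue ht).deriv]
  positivity

theorem deriv_deriv_convexGlue_pos {t : ℝ} (ht : 0 < t) : 0 < deriv (deriv convexGlue) t := by
  have h : deriv convexGlue =ᶠ[𝓝 t] fun s => Real.exp (-s⁻¹) * (1 + s⁻¹) := by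
    filter_upwards [Ioi_mem_nhds ht] with s hs using (hasDerivAt_convexGlue hs).deriv
  have h1 := ((hasDerivAt_inv ht.ne').fun_neg.exp).fun_mul ((hasDerivAt_inv ht.ne').const_add 1)
  rw [h.deriv_eq, h1.deriv]
  have : Real.exp (-t⁻¹) * -(-(t ^ 2)⁻¹) * (1 + t⁻¹) + Real.exp (-t⁻¹) * -(t ^ 2)⁻¹ =
      Real.exp (-t⁻¹) * (t ^ 2)⁻¹ * t⁻¹ := by ring
  rw [this]
  positivity

/-- Supplies the value at the gluing point `t = 0`, where the explicit formulas for the derivatives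
of `convexGlue` are not available. -/
theorem nonneg_of_continuous_of_pos {h : ℝ → ℝ} (hc : Continuous h) (hpos : ∀ t, 0 < t → 0 < h t)
    {t : ℝ} (ht : 0 ≤ t) : 0 ≤ h t := by
  rcases ht.eq_or_lt with rfl | ht
  · refine ge_of_tendsto (hc.continuousAt.tendsto.mono_left (nhdsWithin_le_nhds (s := Set.Ioi 0))) ?_
    filter_upwards [self_mem_nhdsWithin] with t ht using (hpos t ht).le
  · exact (hpos t ht).le

theorem deriv_convexGlue_nonneg {t : ℝ} (ht : 0 ≤ t) : 0 ≤ deriv convexGlue t :=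
  nonneg_of_continuous_of_pos (contDiff_convexGlue.continuous_deriv (by simp))
    (fun _ => deriv_convexGlue_pos) ht

theorem deriv_deriv_convexGlue_nonneg {t : ℝ} (ht : 0 ≤ t) : 0 ≤ deriv (deriv convexGlue) t := by
  have h : ContDiff ℝ ∞ (deriv convexGlue) := (contDiff_infty_iff_deriv.1 contDiff_convexGlue).2
  exact nonneg_of_continuous_of_pos (h.continuous_deriv (by simp))
    (fun _ => deriv_deriv_convexGlue_pos) ht

/-- For `t ≥ 1` one has `exp(-1/t) ≥ exp(-1)`, so `convexGlue` grows at least linearly. This is the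
role of the factor `t`: `expNegInvGlue` alone is bounded, and composing with it would not preserve
exhaustions. -/
theorem le_of_convexGlue_le {t c : ℝ} (h : convexGlue t ≤ c) : t ≤ max 1 (c * Real.exp 1) := by
  rcases le_or_gt t 1 with ht | ht
  · exact ht.trans (le_max_left _ _)
  refine le_trans ?_ (le_max_right _ _)
  have h0 : 0 < t := by linarith
  rw [convexGlue, expNegInvGlue, if_neg (not_le.2 h0)] at h
  have h1 : Real.exp (-1) ≤ Real.exp (-t⁻¹) :=
    Real.exp_le_exp.2 (neg_le_neg (inv_le_one_of_one_le₀ ht.le))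
  have h2 : t * Real.exp (-1) ≤ c := (mul_le_mul_of_nonneg_left h1 h0.le).trans h
  calc t = t * Real.exp (-1) * Real.exp 1 := by rw [mul_assoc, ← Real.exp_add]; simp
    _ ≤ c * Real.exp 1 := by gcongr

/-! ### Strictness near the boundary, and convexity at infinity -/

namespace GromovStructure

variable {E : Type*} [NormedAddCommGroup E] [NormedSpace ℝ E] [FiniteDimensional ℝ E]
  {X : Type*} [TopologicalSpace X] [ChartedSpace E X] [IsManifold 𝓘(ℝ, E) ∞ X]
  (G : GromovStructure E X)

/-- Here `q` is the squared norm of `du` restricted to `W`; only its sign is used afterwards. -/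
theorem hessTrace_real_comp {u : X → ℝ} {χ : ℝ → ℝ} {x : X}
    (hu : ContMDiffAt 𝓘(ℝ, E) 𝓘(ℝ, ℝ) 2 u x) (hχ : ContDiffAt ℝ 2 χ (u x))
    (W : Submodule ℝ (TangentSpace 𝓘(ℝ, E) x)) :
    ∃ q : ℝ, 0 ≤ q ∧ G.hessTrace (fun z => χ (u z)) x W =
      deriv χ (u x) * G.hessTrace u x W + deriv (deriv χ) (u x) * q := by
  obtain ⟨e, he⟩ := G.exists_orthonormal_basis x W
  refine ⟨∑ i, differential u x (e i : TangentSpace 𝓘(ℝ, E) x) ^ 2, Finset.sum_nonneg fun _ _ => sq_nonneg _, ?_⟩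
  rw [G.hessTrace_eq_sum _ x W e he, G.hessTrace_eq_sum _ x W e he, Finset.mul_sum, Finset.mul_sum,
    ← Finset.sum_add_distrib]
  refine Finset.sum_congr rfl fun i _ => ?_
  rw [G.hess_real_comp hu hχ, sq]

omit [FiniteDimensional ℝ E] in
theorem linearIndependent_of_orthonormal {x : X} {ι : Type*} [Fintype ι] [DecidableEq ι]
    {e : ι → TangentSpace 𝓘(ℝ, E) x}
    (he : ∀ i j, G.metric x (e i) (e j) = if i = j then 1 else 0) : LinearIndependent ℝ e := by
  rw [Fintype.linearIndependent_iff]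
  intro c hc j
  have := congrArg (fun v => G.metric x v (e j)) hc
  simpa [sum_apply, he] using this

/-- An isotropic orthonormal frame with half as many elements as the dimension spans a Lagrangian plane,
of which it is an orthonormal basis. -/
theorem exists_isLagrangian_of_orthonormal {x : X} {d : ℕ} (hd : 2 * d = Module.finrank ℝ E)
    {e : Fin d → TangentSpace 𝓘(ℝ, E) x}
    (he : ∀ i j, G.metric x (e i) (e j) = if i = j then 1 else 0)
    (hiso : ∀ i j, G.form x (e i) (e j) = 0) :
    ∃ W : Submodule ℝ (TangentSpace 𝓘(ℝ, E) x), G.IsLagrangian x W ∧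
      (∀ ℓ : TangentSpace 𝓘(ℝ, E) x →L[ℝ] ℝ, (∀ i, ℓ (e i) = 0) → ∀ w ∈ W, ℓ w = 0) ∧
      ∀ u : X → ℝ, G.hessTrace u x W = ∑ i, G.hess u x (e i) (e i) := by
  have hli := G.linearIndependent_of_orthonormal he
  have hspan (ℓ : TangentSpace 𝓘(ℝ, E) x →L[ℝ] ℝ) (hℓ : ∀ i, ℓ (e i) = 0) :
      ∀ w ∈ Submodule.span ℝ (Set.range e), ℓ w = 0 := fun w hw =>
    Submodule.span_induction (p := fun w _ => ℓ w = 0) (by rintro _ ⟨i, rfl⟩; exact hℓ i) (map_zero ℓ)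
      (fun v w _ _ hv hw => by simp [hv, hw]) (fun c v _ hv => by simp [hv]) hw
  refine ⟨Submodule.span ℝ (Set.range e), ⟨?_, fun v hv w hw => ?_⟩, hspan, fun u => ?_⟩
  · rw [finrank_span_eq_card hli, Fintype.card_fin, hd]
  · refine hspan (G.form x v) (fun j => ?_) w hw
    exact Submodule.span_induction (p := fun v _ => G.form x v (e j) = 0)
      (by rintro _ ⟨i, rfl⟩; exact hiso i j) (by simp)
      (fun v w _ _ hv hw => by simp [hv, hw]) (fun c v _ hv => by simp [hv]) hv
  · rw [G.hessTrace_eq_sum u x _ (Module.Basis.span hli) (by simpa [Module.Basis.span_apply] using he)]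
    simp [Module.Basis.span_apply]

omit [FiniteDimensional ℝ E] in
theorem hess_neg_log {ρ : X → ℝ} {x : X} (hρ : ContMDiffAt 𝓘(ℝ, E) 𝓘(ℝ, ℝ) 2 ρ x) (hx : ρ x < 0)
    (v : TangentSpace 𝓘(ℝ, E) x) :
    G.hess (fun z => -Real.log (-ρ z)) x v v =
      (-ρ x)⁻¹ * (G.hess ρ x v v + (-ρ x)⁻¹ * differential ρ x v ^ 2) := by
  have hlog : ContDiffAt ℝ 2 (fun t : ℝ => -Real.log (-t)) (ρ x) :=
    ((contDiffAt_id.neg).log (neg_ne_zero.2 hx.ne)).neg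
  rw [G.hess_real_comp hρ hlog, (hasDerivAt_neg_log_neg hx).deriv, deriv_deriv_neg_log_neg hx]
  ring

/-- The hessian of any defining function has positive trace on the frames, in the chart at a boundary
point, that are tangential, orthonormal and isotropic. -/
theorem sum_coordHess_pos {Ω : Set X} (hΩ : IsOpen Ω) {ρ ρ₀ : X → ℝ}
    (hρ : IsDefiningFunction E ρ Ω) (hρ₀ : IsDefiningFunction E ρ₀ Ω) {x₀ : X}
    (hx₀ : x₀ ∈ frontier Ω)
    (hconv : ∀ W, G.IsLagrangian x₀ W →
      (∀ w ∈ W, mfderiv 𝓘(ℝ, E) 𝓘(ℝ, ℝ) ρ₀ x₀ w = 0) → 0 < G.hessTrace ρ₀ x₀ W)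
    {d : ℕ} (hd : 2 * d = Module.finrank ℝ E) (a : Fin d → E)
    (ha : ∀ i j, formInChart G.metric x₀ (extChartAt 𝓘(ℝ, E) x₀ x₀) (a i) (a j) =
      if i = j then 1 else 0)
    (hiso : ∀ i j, formInChart G.form x₀ (extChartAt 𝓘(ℝ, E) x₀ x₀) (a i) (a j) = 0)
    (htan : ∀ i, fderiv ℝ (ρ ∘ (extChartAt 𝓘(ℝ, E) x₀).symm) (extChartAt 𝓘(ℝ, E) x₀ x₀) (a i) = 0) :
    0 < ∑ i, coordHess (formInChart G.metric x₀) (ρ ∘ (extChartAt 𝓘(ℝ, E) x₀).symm)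
      (extChartAt 𝓘(ℝ, E) x₀ x₀) (a i) (a i) := by
  have hxx := mem_extChartAt_source (I := 𝓘(ℝ, E)) x₀
  have hxc := frontier_subset_closure hx₀
  have hinv : (extChartAt 𝓘(ℝ, E) x₀).symm (extChartAt 𝓘(ℝ, E) x₀ x₀) = x₀ :=
    (extChartAt 𝓘(ℝ, E) x₀).left_inv hxx
  have hsm {q : X → ℝ} (hq : IsDefiningFunction E q Ω) (n : ℕ∞) :
      ContMDiffAt 𝓘(ℝ, E) 𝓘(ℝ, ℝ) n q x₀ :=
    (hq.contMDiffAt hxc).of_le (by exact_mod_cast le_top)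
  have hne {q : X → ℝ} (hq : IsDefiningFunction E q Ω) :
      fderiv ℝ (q ∘ (extChartAt 𝓘(ℝ, E) x₀).symm) (extChartAt 𝓘(ℝ, E) x₀ x₀) ≠ 0 := by
    intro h0
    refine hq.mfderiv_ne_zero x₀ hx₀ ?_
    have (v : TangentSpace 𝓘(ℝ, E) x₀) : differential q x₀ v = 0 := by
      rw [← fderiv_comp_extChartAt_symm_apply hxx (hsm hq 1) v, h0]
      rfl
    exact ContinuousLinearMap.ext this
  have hev : ∀ᶠ z in 𝓝 (extChartAt 𝓘(ℝ, E) x₀ x₀),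
      (ρ ∘ (extChartAt 𝓘(ℝ, E) x₀).symm) z < 0 → (ρ₀ ∘ (extChartAt 𝓘(ℝ, E) x₀).symm) z < 0 := by
    have hc := (contMDiffAt_extChartAt_symm
      (mem_extChartAt_target (I := 𝓘(ℝ, E)) x₀)).continuousAt.tendsto
    rw [hinv] at hc
    filter_upwards [hc.eventually (hρ.eventually_mem_iff hxc),
      hc.eventually (hρ₀.eventually_mem_iff hxc)] with z h1 h2 h3
    exact h2.1 (h1.2 h3)
  obtain ⟨c, hc, hcd, hcle⟩ := exists_pos_fderiv_eq_smul_and_le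
    (contDiffAt_comp_extChartAt_symm (n := 2) hxx (hsm hρ 2))
    (contDiffAt_comp_extChartAt_symm (n := 2) hxx (hsm hρ₀ 2))
    (by rw [Function.comp_apply, hinv, hρ.eq_zero hΩ hx₀])
    (by rw [Function.comp_apply, hinv, hρ₀.eq_zero hΩ hx₀]) hev (hne hρ) (hne hρ₀)
  have htan₀ (i) : fderiv ℝ (ρ₀ ∘ (extChartAt 𝓘(ℝ, E) x₀).symm) (extChartAt 𝓘(ℝ, E) x₀ x₀) (a i) = 0 := by
    have := htan i
    rw [hcd] at this
    simpa [hc.ne'] using this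
  -- The differentials are exactly proportional, so the Christoffel terms scale by the same `c` and
  -- the inequality of second derivatives passes to the hessians.
  have hle (i) : c * coordHess (formInChart G.metric x₀) (ρ₀ ∘ (extChartAt 𝓘(ℝ, E) x₀).symm)
      (extChartAt 𝓘(ℝ, E) x₀ x₀) (a i) (a i) ≤
      coordHess (formInChart G.metric x₀) (ρ ∘ (extChartAt 𝓘(ℝ, E) x₀).symm)
      (extChartAt 𝓘(ℝ, E) x₀ x₀) (a i) (a i) := by
    have := hcle (a i) (htan₀ i)
    simp only [coordHess, hcd, smul_apply, smul_eq_mul]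
    linarith
  let e (i : Fin d) : TangentSpace 𝓘(ℝ, E) x₀ :=
    (mfderiv 𝓘(ℝ, E) 𝓘(ℝ, E) (extChartAt 𝓘(ℝ, E) x₀).symm (extChartAt 𝓘(ℝ, E) x₀ x₀) (a i) : E)
  have hea (i) : (mfderiv 𝓘(ℝ, E) 𝓘(ℝ, E) (extChartAt 𝓘(ℝ, E) x₀) x₀ (e i) : E) = a i :=
    mfderiv_extChartAt_apply_symm hxx (a i)
  have hform (B : (x : X) → TangentSpace 𝓘(ℝ, E) x →L[ℝ] TangentSpace 𝓘(ℝ, E) x →L[ℝ] ℝ) (i j) :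
      formInChart B x₀ (extChartAt 𝓘(ℝ, E) x₀ x₀) (a i) (a j) = B x₀ (e i) (e j) := by
    rw [← formInChart_extChartAt B hxx (e i) (e j)]
    exact congrArg₂ (fun v w => formInChart B x₀ (extChartAt 𝓘(ℝ, E) x₀ x₀) v w) (hea i).symm (hea j).symm
  obtain ⟨W, hW, hWtan, hWtr⟩ := G.exists_isLagrangian_of_orthonormal hd (e := e)
    (fun i j => (hform _ i j).symm.trans (ha i j)) (fun i j => (hform _ i j).symm.trans (hiso i j))
  have hpos := hconv W hW (hWtan (differential ρ₀ x₀) fun i => by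
    rw [← fderiv_comp_extChartAt_symm_apply hxx (hsm hρ₀ 1) (e i)]
    exact (congrArg _ (hea i)).trans (htan₀ i))
  rw [hWtr] at hpos
  calc 0 < c * ∑ i, G.hess ρ₀ x₀ (e i) (e i) := mul_pos hc hpos
    _ = ∑ i, c * coordHess (formInChart G.metric x₀) (ρ₀ ∘ (extChartAt 𝓘(ℝ, E) x₀).symm)
        (extChartAt 𝓘(ℝ, E) x₀ x₀) (a i) (a i) := by
      rw [Finset.mul_sum]
      refine Finset.sum_congr rfl fun i _ => ?_
      rw [G.hess_eq_coordHess hxx (hsm hρ₀ 2) (e i) (e i)]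
      exact congrArg (c * ·) (congrArg₂ (coordHess _ _ _) (hea i) (hea i))
    _ ≤ _ := Finset.sum_le_sum fun i _ => hle i

theorem eventually_hessTrace_neg_log_pos {Ω : Set X} (hΩ : IsOpen Ω) {ρ ρ₀ : X → ℝ}
    (hρ : IsDefiningFunction E ρ Ω) (hρ₀ : IsDefiningFunction E ρ₀ Ω) {x₀ : X}
    (hx₀ : x₀ ∈ frontier Ω)
    (hconv : ∀ W, G.IsLagrangian x₀ W →
      (∀ w ∈ W, mfderiv 𝓘(ℝ, E) 𝓘(ℝ, ℝ) ρ₀ x₀ w = 0) → 0 < G.hessTrace ρ₀ x₀ W) :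
    ∀ᶠ x in 𝓝 x₀, x ∈ Ω → ∀ W, G.IsLagrangian x W →
      0 < G.hessTrace (fun z => -Real.log (-ρ z)) x W := by
  -- In odd dimension there are no Lagrangian planes. Otherwise the frames at all points share the
  -- index type `Fin d`, as the compactness argument requires.
  by_cases hd : ∃ d, 2 * d = Module.finrank ℝ E
  swap
  · exact Eventually.of_forall fun x _ W hW => absurd ⟨_, hW.1⟩ hd
  obtain ⟨d, hd⟩ := hd
  have hxx := mem_extChartAt_source (I := 𝓘(ℝ, E)) x₀
  have hxc := frontier_subset_closure hx₀
  have hinv : (extChartAt 𝓘(ℝ, E) x₀).symm (extChartAt 𝓘(ℝ, E) x₀ x₀) = x₀ :=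
    (extChartAt 𝓘(ℝ, E) x₀).left_inv hxx
  have hr : ContDiffAt ℝ 2 (ρ ∘ (extChartAt 𝓘(ℝ, E) x₀).symm) (extChartAt 𝓘(ℝ, E) x₀ x₀) :=
    contDiffAt_comp_extChartAt_symm (n := 2) hxx
      ((hρ.contMDiffAt hxc).of_le (WithTop.coe_le_coe.2 le_top))
  have hg := G.contDiffAt_metric hxx
  have hform : ContinuousAt (formInChart G.form x₀) (extChartAt 𝓘(ℝ, E) x₀ x₀) :=
    ((contDiffOn_formInChart G.contMDiff_form x₀).contDiffAt
      ((isOpen_extChartAt_target x₀).mem_nhds (mem_extChartAt_target x₀))).continuousAt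
  have hev := eventually_sum_add_inv_mul_sq_pos (ι := Fin d) hg.continuousAt
    (fun v hv => G.formInChart_metric_pos hxx hv) hform hr.continuousAt
    (by rw [Function.comp_apply, hinv, hρ.eq_zero hΩ hx₀])
    (hr.fderiv_right (m := 1) (by norm_num)).continuousAt
    (H := fun y v => coordHess (formInChart G.metric x₀) (ρ ∘ (extChartAt 𝓘(ℝ, E) x₀).symm) y v v)
    (fun v => continuousAt_coordHess (hg.of_le (by simp)) (G.isInvertible_formInChart_metric hxx) hr v)
    (G.sum_coordHess_pos hΩ hρ hρ₀ hx₀ hconv hd)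
  filter_upwards [(contMDiffAt_extChartAt_of_mem hxx).continuousAt.eventually hev,
    (isOpen_extChartAt_source (I := 𝓘(ℝ, E)) x₀).mem_nhds hxx] with x hx hxs hxΩ W hW
  have hρx := hρ.contMDiffAt (subset_closure hxΩ)
  have hρx1 : ContMDiffAt 𝓘(ℝ, E) 𝓘(ℝ, ℝ) 1 ρ x := hρx.of_le (by simp)
  have hρx2 : ContMDiffAt 𝓘(ℝ, E) 𝓘(ℝ, ℝ) 2 ρ x := hρx.of_le (WithTop.coe_le_coe.2 le_top)
  have hinvx : (extChartAt 𝓘(ℝ, E) x₀).symm (extChartAt 𝓘(ℝ, E) x₀ x) = x :=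
    (extChartAt 𝓘(ℝ, E) x₀).left_inv hxs
  obtain ⟨e', he'⟩ := G.exists_orthonormal_basis x W
  have hdW : Module.finrank ℝ W = d := by have := hW.1; omega
  set e := e'.reindex (finCongr hdW)
  have he : ∀ i j, G.metric x (e i) (e j) = if i = j then 1 else 0 := fun i j => by
    simp [e, he']
  have hpos := hx (by rw [Function.comp_apply, hinvx]; exact hρ.neg hxΩ)
    (fun i => (mfderiv 𝓘(ℝ, E) 𝓘(ℝ, E) (extChartAt 𝓘(ℝ, E) x₀) x (e i) : E))
    (fun i j => (formInChart_extChartAt G.metric hxs _ _).trans (he i j))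
    (fun i j => (formInChart_extChartAt G.form hxs _ _).trans (hW.2 _ (e i).2 _ (e j).2))
  rw [G.hessTrace_eq_sum _ x W e he]
  have hterm (i) : G.hess (fun z => -Real.log (-ρ z)) x (e i) (e i) = (-ρ x)⁻¹ *
      (coordHess (formInChart G.metric x₀) (ρ ∘ (extChartAt 𝓘(ℝ, E) x₀).symm)
        (extChartAt 𝓘(ℝ, E) x₀ x)
        (mfderiv 𝓘(ℝ, E) 𝓘(ℝ, E) (extChartAt 𝓘(ℝ, E) x₀) x (e i) : E)
        (mfderiv 𝓘(ℝ, E) 𝓘(ℝ, E) (extChartAt 𝓘(ℝ, E) x₀) x (e i) : E) +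
      (-(ρ ∘ (extChartAt 𝓘(ℝ, E) x₀).symm) (extChartAt 𝓘(ℝ, E) x₀ x))⁻¹ *
        fderiv ℝ (ρ ∘ (extChartAt 𝓘(ℝ, E) x₀).symm) (extChartAt 𝓘(ℝ, E) x₀ x)
          (mfderiv 𝓘(ℝ, E) 𝓘(ℝ, E) (extChartAt 𝓘(ℝ, E) x₀) x (e i) : E) ^ 2) := by
    rw [G.hess_neg_log hρx2 (hρ.neg hxΩ), Function.comp_apply, hinvx,
      G.hess_eq_coordHess hxs hρx2]
    have := fderiv_comp_extChartAt_symm_apply hxs hρx1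
      (e i : TangentSpace 𝓘(ℝ, E) x)
    rw [← this]
  rw [Finset.sum_congr rfl fun i _ => hterm i, ← Finset.mul_sum]
  exact mul_pos (inv_pos.2 (neg_pos.2 (hρ.neg hxΩ))) hpos

/-- Each boundary point is interior to the set `N` where strict positivity holds (vacuously off
`Ω`). Hence the closure of `Ω` minus the interior of `N` is compact and misses the boundary. -/
theorem exists_strictLagPshOn_neg_log {Ω : Set X} (hΩ : IsOpen Ω) (hΩc : IsCompact (closure Ω))
    (hconv : G.StrictLagConvexBoundary Ω) {ρ : X → ℝ} (hρ : IsDefiningFunction E ρ Ω) :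
    ∃ K ⊆ Ω, IsCompact K ∧ G.StrictLagPshOn (fun x => -Real.log (-ρ x)) (Ω \ K) := by
  obtain ⟨ρ₀, hρ₀, hconv⟩ := hconv
  set N := {x | x ∈ Ω → ∀ W, G.IsLagrangian x W → 0 < G.hessTrace (fun z => -Real.log (-ρ z)) x W}
  have hN : frontier Ω ⊆ interior N := fun x hx => mem_interior_iff_mem_nhds.2
    (G.eventually_hessTrace_neg_log_pos hΩ hρ hρ₀ hx (hconv x hx))
  refine ⟨closure Ω \ interior N, fun x hx => ?_, hΩc.diff isOpen_interior,
    fun x hx => (hρ.contMDiffAt_neg_log hx.1).contMDiffWithinAt, fun x hx W hW => ?_⟩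
  · by_contra hxΩ
    exact hx.2 (hN ⟨hx.1, fun h => hxΩ (interior_subset h)⟩)
  · have : x ∈ interior N := by
      by_contra h
      exact hx.2 ⟨subset_closure hx.1, h⟩
    exact interior_subset this hx.1 W hW

/-- The composition with `convexGlue` flattens `v` on a neighbourhood of `K`, where nothing is known
about its hessian, and keeps strictness where `v` exceeds the level `m`. -/
theorem exhaustionStrictAtInfinity_of_strictLagPshOn [T2Space X] {Ω K : Set X} (hΩ : IsOpen Ω) (hKΩ : K ⊆ Ω)
    (hK : IsCompact K) {v : X → ℝ} (hv : ContMDiffOn 𝓘(ℝ, E) 𝓘(ℝ, ℝ) ∞ v Ω)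
    (hvK : G.StrictLagPshOn v (Ω \ K)) (hcomp : ∀ c, IsCompact {x ∈ Ω | v x ≤ c}) :
    G.ExhaustionStrictAtInfinity Ω := by
  obtain ⟨m, hm⟩ : ∃ m, ∀ x ∈ K, v x < m := by
    obtain ⟨m, hm⟩ := hK.bddAbove_image (hv.continuousOn.mono hKΩ)
    -- Adding 1 makes the bound strict, so that every point with `v ≥ m`, including `v = m`, lies
    -- outside `K`.
    exact ⟨m + 1, fun x hx => (hm ⟨x, hx, rfl⟩).trans_lt (lt_add_one m)⟩
  have hχ : ContDiff ℝ ∞ fun t => convexGlue (t - m) :=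
    contDiff_convexGlue.comp (contDiff_id.sub contDiff_const)
  have hχ1 : deriv (fun t => convexGlue (t - m)) = fun t => deriv convexGlue (t - m) :=
    funext fun t => deriv_comp_sub_const convexGlue m t
  have hχ2 : deriv (deriv fun t => convexGlue (t - m)) = fun t => deriv (deriv convexGlue) (t - m) := by
    rw [hχ1]
    exact funext fun t => deriv_comp_sub_const (deriv convexGlue) m t
  have hvat {x : X} (hx : x ∈ Ω) : ContMDiffAt 𝓘(ℝ, E) 𝓘(ℝ, ℝ) ∞ v x := hv.contMDiffAt (hΩ.mem_nhds hx)
  have hsmooth : ContMDiffOn 𝓘(ℝ, E) 𝓘(ℝ, ℝ) ∞ (fun x => convexGlue (v x - m)) Ω :=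
    hχ.contMDiff.comp_contMDiffOn hv
  have htr {x : X} (hx : x ∈ Ω) (W : Submodule ℝ (TangentSpace 𝓘(ℝ, E) x)) :
      ∃ q : ℝ, 0 ≤ q ∧ G.hessTrace (fun z => convexGlue (v z - m)) x W =
        deriv convexGlue (v x - m) * G.hessTrace v x W +
          deriv (deriv convexGlue) (v x - m) * q := by
    have := G.hessTrace_real_comp (χ := fun t => convexGlue (t - m)) ((hvat hx).of_le (WithTop.coe_le_coe.2 le_top))
      (hχ.contDiffAt.of_le (WithTop.coe_le_coe.2 le_top)) W
    rwa [hχ2, hχ1] at this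
  have hnotK {x : X} (hx : m ≤ v x) : x ∉ K := fun h => (hm x h).not_ge hx
  refine ⟨fun x => convexGlue (v x - m), ⟨hsmooth, fun x hx W hW => ?_⟩, fun c => ?_,
    {x ∈ Ω | v x ≤ m}, Set.sep_subset _ _, hcomp m, hsmooth.mono Set.sdiff_subset, fun x hx W hW => ?_⟩
  -- Below the level `m` the function is locally zero. On `v = m` the derivatives of `convexGlue`
  -- are merely nonnegative, which suffices for the weak inequality.
  · rcases lt_or_ge (v x) m with hlt | hge
    · have h0 : (fun x => convexGlue (v x - m)) =ᶠ[𝓝 x] fun _ => 0 := by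
        filter_upwards [(hvat hx).continuousAt.eventually_lt_const hlt] with z hz
        exact convexGlue_of_nonpos (by linarith)
      obtain ⟨e, he⟩ := G.exists_orthonormal_basis x W
      rw [G.hessTrace_eq_sum _ x W e he, G.hess_congr h0]
      refine (Finset.sum_nonneg fun i _ => ?_)
      refine le_of_eq ?_
      exact (coordHess_const _ _ _ _ _).symm
    · obtain ⟨q, hq, hqe⟩ := htr hx W
      rw [hqe]
      exact add_nonneg (mul_nonneg (deriv_convexGlue_nonneg (by linarith))
        (hvK.2 x ⟨hx, hnotK hge⟩ W hW).le) (mul_nonneg (deriv_deriv_convexGlue_nonneg (by linarith)) hq)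
  · have hsub : {x ∈ Ω | convexGlue (v x - m) ≤ c} ⊆ {x ∈ Ω | v x ≤ max 1 (c * Real.exp 1) + m} :=
      fun x hx => ⟨hx.1, by linarith [le_of_convexGlue_le hx.2]⟩
    -- Continuity is known only on `Ω`, so closedness in `X` is obtained inside a compact sublevel
    -- set of `v`.
    have hclosed := ContinuousOn.preimage_isClosed_of_isClosed
      (hsmooth.continuousOn.mono (Set.sep_subset _ _))
      (hcomp (max 1 (c * Real.exp 1) + m)).isClosed (isClosed_Iic (a := c))
    refine (hcomp (max 1 (c * Real.exp 1) + m)).of_isClosed_subset ?_ hsub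
    convert hclosed using 1
    ext x
    exact ⟨fun hx => ⟨hsub hx, hx.2⟩, fun hx => ⟨hx.1.1, hx.2⟩⟩
  · have hgt : m < v x := not_le.1 fun h => hx.2 ⟨hx.1, h⟩
    obtain ⟨q, hq, hqe⟩ := htr hx.1 W
    rw [hqe]
    exact add_pos_of_pos_of_nonneg (mul_pos (deriv_convexGlue_pos (by linarith))
      (hvK.2 x ⟨hx.1, hnotK hgt.le⟩ W hW)) (mul_nonneg (deriv_deriv_convexGlue_nonneg (by linarith)) hq)

variable {G} in
theorem ExhaustionStrictAtInfinity.hullConvexStrictAtInfinity {Ω : Set X}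
    (h : G.ExhaustionStrictAtInfinity Ω) : G.HullConvexStrictAtInfinity Ω := by
  obtain ⟨f, hf, hcomp, hstrict⟩ := h
  refine ⟨fun K hKΩ hK => ?_, f, hf.1, hstrict⟩
  obtain ⟨c, hc⟩ := hK.bddAbove_image (hf.1.continuousOn.mono hKΩ)
  exact ⟨{x ∈ Ω | f x ≤ c}, Set.sep_subset _ _, hcomp c,
    fun x hx => ⟨hx.1, hx.2 f hf c fun y hy => hc ⟨y, hy, rfl⟩⟩⟩

end GromovStructure

end

theorem theorem10p5 {E : Type*} [NormedAddCommGroup E] [NormedSpace ℝ E] [FiniteDimensional ℝ E]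
    {X : Type*} [TopologicalSpace X] [T2Space X] [ChartedSpace E X] [IsManifold 𝓘(ℝ, E) ∞ X]
    (G : GromovStructure E X) (Ω : Set X) (hΩ : IsOpen Ω) (hΩc : IsCompact (closure Ω))
    (hconv : G.StrictLagConvexBoundary Ω) :
    (∀ ρ : X → ℝ, IsDefiningFunction E ρ Ω →
      ∃ K ⊆ Ω, IsCompact K ∧ G.StrictLagPshOn (fun x => -Real.log (-ρ x)) (Ω \ K)) ∧
    G.StrictLagConvexAtInfinity Ω := by
  refine ⟨fun ρ hρ => G.exists_strictLagPshOn_neg_log hΩ hΩc hconv hρ, ?_⟩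
  obtain ⟨ρ, hρ, -⟩ := id hconv
  obtain ⟨K, hKΩ, hK, hpsh⟩ := G.exists_strictLagPshOn_neg_log hΩ hΩc hconv hρ
  have hexh := G.exhaustionStrictAtInfinity_of_strictLagPshOn hΩ hKΩ hK
    (fun x hx => (hρ.contMDiffAt_neg_log hx).contMDiffWithinAt) hpsh (hρ.isCompact_sublevel hΩc)
  refine ⟨hexh.hullConvexStrictAtInfinity, hexh, K, hKΩ, hK, _, hpsh, fun c => ?_⟩
  -- A sublevel set of `-log δ` need not contain `K`, hence the union.
  refine ⟨K ∪ {x ∈ Ω | -Real.log (-ρ x) ≤ c}, Set.union_subset hKΩ (Set.sep_subset _ _),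
    hK.union (hρ.isCompact_sublevel hΩc c), Set.subset_union_left, fun x hx => ?_⟩
  exact not_le.1 fun h => hx.2 (Or.inr ⟨hx.1, h⟩)
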